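/- Let $\Gamma$ be a discrete group with left regular representation $\lambda$ on $\ell^2(\Gamma)$, let $C^*_r(\Gamma)\subseteq B(\ell^2(\Gamma))$ be its reduced group $C^*$-algebra (the norm closed $*$-algebra generated by $\lambda(\Gamma)$), and let $\mathfrak M(\Gamma)=\lambda(\Gamma)''$ be its group von Neumann algebra, with predual $\mathfrak M(\Gamma)_*$. Let $A(\Gamma)$ be the Fourier algebra, that is, the set of matrix coefficients $x\mapsto\langle\lambda(x)f,g\rangle$ with $f,g\in\ell^2(\Gamma)$; it is identified with $\mathfrak M(\Gamma)_*$ by letting $a\in\mathfrak M(\Gamma)$ act on this coefficient as $\langle af,g\rangle$, and $\|\cdot\|_{A(\Gamma)}$ is the norm of functionals, $$\|u\|_{A(\Gamma)}=\sup\Big\{\Big|\sum_x c(x)u(x)\Big| : c\colon\Gamma\to\mathbb C \text{ finitely supported},\ \Big\|\sum_x c(x)\lambda(x)\Big\|\le 1\Big\}.$$ For a function $\phi$ on $\Gamma$ such that $\phi\psi\in A(\Gamma)$ for all $\psi\in A(\Gamma)$, let $m_\phi\colon A(\Gamma)\to A(\Gamma)$, $m_\phi\psi=\phi\psi$, and let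 $\|\phi\|_{M_0A(\Gamma)}=\|m_\phi^*\|_{CB}\in[0,\infty]$ be the completely bounded norm of the transposed operator $m_\phi^*$ on $\mathfrak M(\Gamma)$; for every other function $\phi$ put $\|\phi\|_{M_0A(\Gamma)}=\infty$. Let $1\le k<\infty$. Then the following three conditions are equivalent. 1. $A(\Gamma)$ has an approximate unit $(\phi_\alpha)$ such that $\|\phi_\alpha\|_{M_0A(\Gamma)}\le k$ for all $\alpha$; here an approximate unit is a net $(\phi_\alpha)$ in $A(\Gamma)$ with $\lim_\alpha\|\phi_\alpha\psi-\psi\|_{A(\Gamma)}=0$ for all $\psi\in A(\Gamma)$. 2. There exists a net $(T_\alpha)$ of finite rank bounded linear operators on $C^*_r(\Gamma)$ such that $\|T_\alpha\|_{CB}\le k$ for all $\alpha$ and $\|T_\alpha x-x\|\to 0$ for all $x\in C^*_r(\Gamma)$. 3. There exists a net $(T_\alpha)$ of $\sigma$-weakly continuous finite rank bounded linear operators on $\mathfrak M(\Gamma)$ such that $\|T_\alpha\|_{CB}\le k$ for all $\alpha$ and $\langle\omega,T_\alpha x-x\rangle\to 0$ for all $x\in\mathfrak M(\Gamma)$ and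 $\omega\in\mathfrak M(\Gamma)_*$. -/

import Mathlib

universe u

open scoped ENNReal InnerProductSpace Topology

noncomputable section

namespace GroupCBAP

/-! ### Completely bounded maps between matrix amplifications of operator algebras -/

section Operators

variable {H : Type*} [NormedAddCommGroup H] [InnerProductSpace ℂ H]

/-- The operator on the Hilbert space direct sum `H ⊕ ⋯ ⊕ H` (`n` copies) given by an
`n × n` matrix of bounded operators on `H`. -/
def matrixOp {n : ℕ} (a : Matrix (Fin n) (Fin n) (H →L[ℂ] H)) :
    PiLp 2 (fun _ : Fin n => H) →L[ℂ] PiLp 2 (fun _ : Fin n => H) :=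
  ((PiLp.continuousLinearEquiv 2 ℂ (fun _ : Fin n => H)).symm :
      (Fin n → H) →L[ℂ] PiLp 2 (fun _ : Fin n => H)).comp
    (ContinuousLinearMap.pi fun i => ∑ j, (a i j).comp (PiLp.proj 2 (fun _ : Fin n => H) j))

theorem matrixOp_apply {n : ℕ} (a : Matrix (Fin n) (Fin n) (H →L[ℂ] H))
    (v : PiLp 2 (fun _ : Fin n => H)) (i : Fin n) :
    matrixOp a v i = ∑ j, a i j (v j) := by
  simp [matrixOp]

variable [CompleteSpace H]

/-- The completely bounded norm `‖T‖_CB = sup_n ‖T ⊗ id_n‖` (possibly `∞`) of a map on an operator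
algebra `A ⊆ B(H)`, where `M_n(A)` has the norm it inherits from `M_n(B(H)) = B(Hⁿ)`. -/
def cbNorm {A : StarSubalgebra ℂ (H →L[ℂ] H)} (T : A →L[ℂ] A) : ℝ≥0∞ :=
  ⨆ (n : ℕ) (a : Matrix (Fin n) (Fin n) A)
    (_ : ‖matrixOp (a.map fun x => (x : H →L[ℂ] H))‖ ≤ 1),
    ‖matrixOp (a.map fun x => (T x : H →L[ℂ] H))‖ₑ

/-- `T` has finite rank. -/
def IsFiniteRank {A : StarSubalgebra ℂ (H →L[ℂ] H)} (T : A →L[ℂ] A) : Prop :=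
  FiniteDimensional ℂ (LinearMap.range (T : A →ₗ[ℂ] A))

/-- The predual `M_*` of a von Neumann algebra `M ⊆ B(H)`, as a set of functionals on `M`: those of
the form `a ↦ ∑ₙ ⟨a ξₙ, ηₙ⟩` with `∑ₙ ‖ξₙ‖² < ∞` and `∑ₙ ‖ηₙ‖² < ∞`. -/
def predual (M : VonNeumannAlgebra H) : Set (M.toStarSubalgebra →L[ℂ] ℂ) :=
  {ω | ∃ ξ η : ℕ → H, Summable (fun n => ‖ξ n‖ ^ 2) ∧ Summable (fun n => ‖η n‖ ^ 2) ∧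
    ∀ a, ω a = ∑' n, ⟪η n, (a : H →L[ℂ] H) (ξ n)⟫_ℂ}

/-- The σ-weak topology `σ(M, M_*)` on a von Neumann algebra. -/
@[reducible] def sigmaWeak (M : VonNeumannAlgebra H) : TopologicalSpace M.toStarSubalgebra :=
  ⨅ ω ∈ predual M, TopologicalSpace.induced ω inferInstance

/-- `T` is continuous for the σ-weak topology on both sides. -/
def IsSigmaWeaklyContinuous {M : VonNeumannAlgebra H}
    (T : M.toStarSubalgebra →L[ℂ] M.toStarSubalgebra) : Prop :=
  Continuous[sigmaWeak M, sigmaWeak M] T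

end Operators

/-! ### The regular representation and its operator algebras -/

section Group

/-- The Hilbert space `ℓ²(Γ)`. -/
abbrev ell2 (Γ : Type*) : Type _ := lp (fun _ : Γ => ℂ) 2

variable {Γ : Type*} [Group Γ]

theorem memℓp_translate (x : Γ) (f : ell2 Γ) :
    Memℓp (fun y => f (x⁻¹ * y) : Γ → ℂ) 2 := by
  have h := lp.memℓp f
  rw [memℓp_gen_iff (by norm_num)] at h ⊢
  exact h.comp_injective (mul_right_injective x⁻¹)

/-- The left regular representation: `(λ(x) f)(y) = f(x⁻¹ y)`. -/
def leftReg (x : Γ) : ell2 Γ →L[ℂ] ell2 Γ :=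
  LinearIsometry.toContinuousLinearMap
    { toFun := fun f => ⟨fun y => f (x⁻¹ * y), memℓp_translate x f⟩
      map_add' := fun _ _ => rfl
      map_smul' := fun _ _ => rfl
      norm_map' := fun f => by
        have h2 : 0 < (2 : ℝ≥0∞).toReal := by norm_num
        rw [lp.norm_eq_tsum_rpow h2, lp.norm_eq_tsum_rpow h2]
        congr 1
        exact (Equiv.mulLeft x⁻¹).tsum_eq (fun y => ‖f y‖ ^ (2 : ℝ≥0∞).toReal) }

theorem leftReg_apply (x : Γ) (f : ell2 Γ) (y : Γ) : leftReg x f y = f (x⁻¹ * y) := rfl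

variable (Γ)

/-- The reduced group C*-algebra: the norm closed *-algebra generated by `λ(Γ)`. -/
def reducedCStar : StarSubalgebra ℂ (ell2 Γ →L[ℂ] ell2 Γ) :=
  (StarAlgebra.adjoin ℂ (Set.range (leftReg (Γ := Γ)))).topologicalClosure

/-- The group von Neumann algebra: the bicommutant of `λ(Γ)`. -/
def groupVN : VonNeumannAlgebra (ell2 Γ) where
  toStarSubalgebra := StarSubalgebra.centralizer ℂ
    (StarSubalgebra.centralizer ℂ (Set.range (leftReg (Γ := Γ))) : Set (ell2 Γ →L[ℂ] ell2 Γ))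
  centralizer_centralizer' := by
    change Set.centralizer (Set.centralizer (StarSubalgebra.centralizer ℂ
      (StarSubalgebra.centralizer ℂ (Set.range (leftReg (Γ := Γ))) :
        Set (ell2 Γ →L[ℂ] ell2 Γ)) : Set (ell2 Γ →L[ℂ] ell2 Γ))) = _
    rw [StarSubalgebra.coe_centralizer, Set.centralizer_centralizer_centralizer]
    rfl

variable {Γ}

/-! ### The Fourier algebra and its completely bounded multipliers -/

/-- The matrix coefficient `x ↦ ⟨λ(x) f, g⟩` of the left regular representation. -/
def coeff (f g : ell2 Γ) (x : Γ) : ℂ := ⟪g, leftReg x f⟫_ℂ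

variable (Γ) in
/-- The Fourier algebra `A(Γ)`: all matrix coefficients of the left regular representation. -/
def fourierAlgebra : Set (Γ → ℂ) := {u | ∃ f g : ell2 Γ, u = coeff f g}

/-- The norm of `A(Γ)`: the norm of `u` as the functional `∑ c(x) λ(x) ↦ ∑ c(x) u(x)` on the group
algebra, normed by its regular representation. The formula makes sense, with values in `[0, ∞]`,
for every function `u`; on `A(Γ)` it is the norm of `u` as an element of the predual
of the group von Neumann algebra. -/
def fourierNorm (u : Γ → ℂ) : ℝ≥0∞ :=
  ⨆ (c : Γ →₀ ℂ) (_ : ‖c.sum fun x z => z • leftReg x‖ ≤ 1), ‖c.sum fun x z => z * u x‖ₑ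

/-- `φ` is a multiplier of `A(Γ)`. -/
def IsMultiplier (φ : Γ → ℂ) : Prop :=
  ∀ ψ ∈ fourierAlgebra Γ, φ * ψ ∈ fourierAlgebra Γ

/-- `S` is the transpose `m_φ^*`, on the dual of `A(Γ)`, of the multiplication `m_φ : ψ ↦ φ ψ`.
The dual of `A(Γ)` is the group von Neumann algebra, where `a` acts on the
coefficient `x ↦ ⟨λ(x) f, g⟩` by `⟨a f, g⟩`; so the condition is `⟨S a, ψ⟩ = ⟨a, φ ψ⟩`. -/
def IsTransposedMultiplication (φ : Γ → ℂ)
    (S : (groupVN Γ).toStarSubalgebra →L[ℂ] (groupVN Γ).toStarSubalgebra) : Prop :=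
  ∀ f g f' g' : ell2 Γ, φ * coeff f g = coeff f' g' → ∀ a : (groupVN Γ).toStarSubalgebra,
    ⟪g, (S a : ell2 Γ →L[ℂ] ell2 Γ) f⟫_ℂ = ⟪g', (a : ell2 Γ →L[ℂ] ell2 Γ) f'⟫_ℂ

/-- The completely bounded multiplier norm `‖φ‖_{M₀A} = ‖m_φ^*‖_CB`; it is `∞` if `φ` is not a
completely bounded multiplier. (The infimum is over the at most one operator `m_φ^*`.) -/
def multiplierCBNorm (φ : Γ → ℂ) : ℝ≥0∞ :=
  ⨅ (S : (groupVN Γ).toStarSubalgebra →L[ℂ] (groupVN Γ).toStarSubalgebra)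
    (_ : IsMultiplier φ ∧ IsTransposedMultiplication φ S), cbNorm S

end Group

end GroupCBAP

end

/-! All three conditions are compared through Schur multipliers. An element `a` of λ(Γ)'' commutes
with right translations, so its matrix entries at (z, y) depend only on z y⁻¹, and the transpose of
multiplication by φ acts on them by multiplication with φ(z y⁻¹). `SchurBound` records a completely
bounded estimate for this kernel through finite sums, hence independently of the algebra on which
the multiplier is later realised.

From 1 to 2 and 3: write φ in A(Γ) as a coefficient of f and g, and truncate f and g to finite sets.
The error is a coefficient with small vectors, hence a small Schur multiplier (`schurBound_coeff`).
Rescaling restores the bound k exactly (`exists_finite_support_approx`). A finitely supported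
multiplier gives finite rank operators on both algebras. Convergence is checked on λ(Γ) for C*_r(Γ),
on matrix entries for the von Neumann algebra, and extends by uniform boundedness.

From 2 or 3 to 1: Haagerup's averaging replaces a finite rank T by φ(x) = ⟨Tλ(x)δ₁, δₓ⟩. Twisting a
matrix of operators by λ(z y⁻¹), applying T and compressing shows that φ is a Schur multiplier with
bound at most that of T (`schurBound_symbol`). Finite rank makes φ square summable (`memℓp_symbol`),
so φ lies in A(Γ). Pointwise convergence to 1 with uniform Schur bounds gives convergence in the
norm of A(Γ) (`tendsto_fourierNorm`). -/

noncomputable section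

namespace GroupCBAP

open Filter ComplexConjugate

/-! ### The regular representations and matrix entries over the basis δ. -/

section Basics

variable {Γ : Type*}

open Classical in
/-- The basis vector of `ℓ²(Γ)` at `x`. -/
def delta (x : Γ) : ell2 Γ := lp.single 2 x 1

open Classical in
theorem delta_apply (x y : Γ) : delta x y = if y = x then 1 else 0 := by
  simp [delta, Pi.single_apply]

theorem norm_delta (x : Γ) : ‖delta x‖ = 1 := by
  simp [delta, lp.norm_single]

theorem inner_delta_left (x : Γ) (f : ell2 Γ) : ⟪delta x, f⟫_ℂ = f x := by
  simp [delta, lp.inner_single_left]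

theorem hasSum_delta (f : ell2 Γ) : HasSum (fun x => f x • delta x) f := by
  classical
  convert lp.hasSum_single (p := 2) (by simp) f using 2 with x
  rw [delta, ← lp.single_smul]
  simp

theorem hasSum_norm_sq (f : ell2 Γ) : HasSum (fun x => ‖f x‖ ^ 2) (‖f‖ ^ 2) := by
  simpa using lp.hasSum_norm (p := 2) (by simp) f

theorem norm_apply_le (f : ell2 Γ) (x : Γ) : ‖f x‖ ≤ ‖f‖ := by
  simpa [inner_delta_left, norm_delta] using norm_inner_le_norm (𝕜 := ℂ) (delta x) f

theorem norm_sq_sum_smul_delta (F : Finset Γ) (ξ : Γ → ℂ) :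
    ‖∑ y ∈ F, ξ y • delta y‖ ^ 2 = ∑ y ∈ F, ‖ξ y‖ ^ 2 := by
  classical
  have := lp.norm_sum_single (E := fun _ : Γ => ℂ) (p := 2) (by simp) ξ F
  simp only [ENNReal.toReal_ofNat, Real.rpow_ofNat] at this
  rw [← this]
  congr 3 with y
  simp [delta, ← lp.single_smul]

theorem memℓp_two_iff {u : Γ → ℂ} : Memℓp u 2 ↔ Summable fun x => ‖u x‖ ^ 2 := by
  rw [memℓp_gen_iff (by simp)]
  simp

theorem tendsto_sum_smul_delta (f : ell2 Γ) :
    Tendsto (fun F : Finset Γ => ∑ x ∈ F, f x • delta x) atTop (𝓝 f) := hasSum_delta f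

/-- Operators on `ℓ²(Γ)` are determined by their matrix entries. -/
theorem clm_ext_entries {a b : ell2 Γ →L[ℂ] ell2 Γ}
    (h : ∀ z y, a (delta y) z = b (delta y) z) : a = b := by
  ext1 f
  refine ((hasSum_delta f).mapL a).unique ?_
  convert (hasSum_delta f).mapL b using 2 with x
  have : a (delta x) = b (delta x) := lp.ext (funext fun z => h z x)
  simp [this]

variable [Group Γ]

theorem leftReg_delta (x y : Γ) : leftReg x (delta y) = delta (x * y) := by
  refine lp.ext (funext fun z => ?_)
  rw [leftReg_apply, delta_apply, delta_apply]
  classical exact if_congr inv_mul_eq_iff_eq_mul rfl rfl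

theorem norm_leftReg_apply (x : Γ) (f : ell2 Γ) : ‖leftReg x f‖ = ‖f‖ := by
  rw [leftReg, LinearIsometry.coe_toContinuousLinearMap, LinearIsometry.norm_map]

theorem norm_leftReg_le (x : Γ) : ‖leftReg x‖ ≤ 1 :=
  ContinuousLinearMap.opNorm_le_bound _ zero_le_one fun f => by simp [norm_leftReg_apply]

theorem leftReg_mul (x y : Γ) : leftReg (x * y) = leftReg x * leftReg y := by
  ext f z
  simp [leftReg_apply, mul_assoc]

theorem leftReg_one : leftReg (1 : Γ) = 1 := by
  ext f z
  simp [leftReg_apply]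

theorem inner_leftReg_right (x : Γ) (f g : ell2 Γ) :
    ⟪g, leftReg x f⟫_ℂ = ⟪leftReg x⁻¹ g, f⟫_ℂ := by
  rw [lp.inner_eq_tsum, lp.inner_eq_tsum, ← (Equiv.mulLeft x).tsum_eq]
  simp [leftReg_apply]

theorem star_leftReg (x : Γ) : star (leftReg x) = leftReg x⁻¹ := by
  rw [ContinuousLinearMap.star_eq_adjoint, eq_comm, ContinuousLinearMap.eq_adjoint_iff]
  intro f g
  rw [inner_leftReg_right]

/-- λ(Γ) is closed under adjoints, hence so is its commutant, and the adjoint half of each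
centralizer condition is automatic. -/
theorem mem_groupVN_iff {a : ell2 Γ →L[ℂ] ell2 Γ} :
    a ∈ (groupVN Γ).toStarSubalgebra ↔
      ∀ b : ell2 Γ →L[ℂ] ell2 Γ, (∀ x, leftReg x * b = b * leftReg x) → b * a = a * b := by
  change a ∈ StarSubalgebra.centralizer ℂ _ ↔ _
  rw [StarSubalgebra.mem_centralizer_iff]
  have key : ∀ b : ell2 Γ →L[ℂ] ell2 Γ,
      b ∈ (StarSubalgebra.centralizer ℂ (Set.range (leftReg (Γ := Γ))) :
        Set (ell2 Γ →L[ℂ] ell2 Γ)) ↔ ∀ x, leftReg x * b = b * leftReg x := by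
    intro b
    rw [SetLike.mem_coe, StarSubalgebra.mem_centralizer_iff]
    constructor
    · exact fun h x => (h _ ⟨x, rfl⟩).1
    · rintro h _ ⟨x, rfl⟩
      rw [star_leftReg]
      exact ⟨h x, h x⁻¹⟩
  constructor
  · exact fun h b hb => (h b ((key b).2 hb)).1
  · exact fun h b hb => ⟨h b ((key b).1 hb), h _ ((key _).1 (star_mem
      (S := StarSubalgebra ℂ (ell2 Γ →L[ℂ] ell2 Γ)) hb))⟩

theorem leftReg_mem_groupVN (x : Γ) : leftReg x ∈ (groupVN Γ).toStarSubalgebra :=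
  mem_groupVN_iff.2 fun _ hb => (hb x).symm

theorem isClosed_groupVN :
    IsClosed ((groupVN Γ).toStarSubalgebra : Set (ell2 Γ →L[ℂ] ell2 Γ)) := by
  have : ((groupVN Γ).toStarSubalgebra : Set (ell2 Γ →L[ℂ] ell2 Γ)) =
      ⋂ (b : ell2 Γ →L[ℂ] ell2 Γ) (_ : ∀ x, leftReg x * b = b * leftReg x),
        {a | b * a = a * b} := by
    ext a
    simp only [SetLike.mem_coe, mem_groupVN_iff, Set.mem_iInter, Set.mem_ofPred_eq]
  rw [this]
  exact isClosed_iInter fun b => isClosed_iInter fun _ =>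
    isClosed_eq (by fun_prop) (by fun_prop)

theorem leftReg_mem_reducedCStar (x : Γ) : leftReg x ∈ reducedCStar Γ :=
  StarSubalgebra.le_topologicalClosure _ (StarAlgebra.subset_adjoin ℂ _ ⟨x, rfl⟩)

theorem isClosed_reducedCStar : IsClosed (reducedCStar Γ : Set (ell2 Γ →L[ℂ] ell2 Γ)) :=
  StarSubalgebra.isClosed_topologicalClosure _

theorem reducedCStar_le_groupVN : reducedCStar Γ ≤ (groupVN Γ).toStarSubalgebra := by
  refine StarSubalgebra.topologicalClosure_minimal ?_ isClosed_groupVN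
  rw [StarAlgebra.adjoin_le_iff]
  rintro _ ⟨x, rfl⟩
  exact leftReg_mem_groupVN x

theorem memℓp_translate_right (x : Γ) (f : ell2 Γ) :
    Memℓp (fun y => f (y * x) : Γ → ℂ) 2 := by
  have h := lp.memℓp f
  rw [memℓp_gen_iff (by norm_num)] at h ⊢
  exact h.comp_injective (mul_left_injective x)

/-- The right regular representation: `(ρ(x) f)(y) = f(y x)`. -/
def rightReg (x : Γ) : ell2 Γ →L[ℂ] ell2 Γ :=
  LinearIsometry.toContinuousLinearMap
    { toFun := fun f => ⟨fun y => f (y * x), memℓp_translate_right x f⟩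
      map_add' := fun _ _ => rfl
      map_smul' := fun _ _ => rfl
      norm_map' := fun f => by
        have h2 : 0 < (2 : ℝ≥0∞).toReal := by norm_num
        rw [lp.norm_eq_tsum_rpow h2, lp.norm_eq_tsum_rpow h2]
        congr 1
        exact (Equiv.mulRight x).tsum_eq (fun y => ‖f y‖ ^ (2 : ℝ≥0∞).toReal) }

theorem rightReg_apply (x : Γ) (f : ell2 Γ) (y : Γ) : rightReg x f y = f (y * x) := rfl

theorem rightReg_delta (x y : Γ) : rightReg x (delta y) = delta (y * x⁻¹) := by
  refine lp.ext (funext fun z => ?_)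
  rw [rightReg_apply, delta_apply, delta_apply]
  classical exact if_congr eq_mul_inv_iff_mul_eq.symm rfl rfl

/-- The matrix entries of `a ∈ λ(Γ)''` are determined by its Fourier coefficients `a δ₁`. -/
theorem groupVN_entry {a : ell2 Γ →L[ℂ] ell2 Γ} (ha : a ∈ (groupVN Γ).toStarSubalgebra)
    (z y : Γ) : a (delta y) z = a (delta 1) (z * y⁻¹) := by
  -- Right translations commute with left ones, and ρ(y⁻¹) carries δ₁ to δ_y.
  have h := mem_groupVN_iff.1 ha (rightReg y⁻¹) fun x => by
    ext f w
    simp [leftReg_apply, rightReg_apply, mul_assoc]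
  have h' := congrArg (fun b => (b (delta 1) : ell2 Γ) z) h
  simpa [rightReg_apply, rightReg_delta] using h'.symm

theorem coeff_eq_inner (f g : ell2 Γ) (x : Γ) : coeff f g x = ⟪g, leftReg x f⟫_ℂ := rfl

theorem norm_coeff_le (f g : ell2 Γ) (x : Γ) : ‖coeff f g x‖ ≤ ‖f‖ * ‖g‖ := by
  rw [coeff_eq_inner, mul_comm, ← norm_leftReg_apply x f]
  exact norm_inner_le_norm _ _

theorem coeff_delta_one (f : ell2 Γ) (x : Γ) : coeff f (delta 1) x = f x⁻¹ := by
  simp [coeff_eq_inner, inner_delta_left, leftReg_apply]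

theorem memℓp_comp_inv {u : Γ → ℂ} (hu : Memℓp u 2) : Memℓp (fun x => u x⁻¹) 2 := by
  rw [memℓp_two_iff] at hu ⊢
  exact hu.comp_injective inv_injective

/-- Square summable functions belong to the Fourier algebra. -/
theorem mem_fourierAlgebra_of_memℓp {u : Γ → ℂ} (hu : Memℓp u 2) : u ∈ fourierAlgebra Γ :=
  ⟨⟨fun x => u x⁻¹, memℓp_comp_inv hu⟩, delta 1, by
    ext x
    rw [coeff_delta_one]
    simp⟩

end Basics

/-! ### Elements of λ(Γ)'' as functionals on coefficients. -/

section DoubleCommutant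

variable {H : Type*} [NormedAddCommGroup H] [InnerProductSpace ℂ H]

/-- The operator `a ⊕ a`. -/
def diagOp (a : H →L[ℂ] H) : PiLp 2 (fun _ : Fin 2 => H) →L[ℂ] PiLp 2 (fun _ : Fin 2 => H) :=
  ((PiLp.continuousLinearEquiv 2 ℂ (fun _ : Fin 2 => H)).symm :
      (Fin 2 → H) →L[ℂ] PiLp 2 (fun _ : Fin 2 => H)).comp
    (ContinuousLinearMap.pi fun i => a.comp (PiLp.proj 2 (fun _ : Fin 2 => H) i))

theorem diagOp_apply (a : H →L[ℂ] H) (v : PiLp 2 (fun _ : Fin 2 => H)) (i : Fin 2) :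
    diagOp a v i = a (v i) := by
  simp [diagOp]

/-- The inclusion of `H` into `H ⊕ H` as the `j`-th summand. -/
def inclOp (j : Fin 2) : H →L[ℂ] PiLp 2 (fun _ : Fin 2 => H) :=
  ((PiLp.continuousLinearEquiv 2 ℂ (fun _ : Fin 2 => H)).symm :
      (Fin 2 → H) →L[ℂ] PiLp 2 (fun _ : Fin 2 => H)).comp
    (ContinuousLinearMap.single ℂ (fun _ : Fin 2 => H) j)

theorem inclOp_apply (j : Fin 2) (v : H) (i : Fin 2) :
    inclOp j v i = (Pi.single j v : Fin 2 → H) i := by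
  simp [inclOp, Pi.single_apply]

theorem diagOp_inclOp (a : H →L[ℂ] H) (j : Fin 2) (v : H) :
    diagOp a (inclOp j v) = inclOp j (a v) := by
  ext i
  rw [diagOp_apply, inclOp_apply, inclOp_apply]
  by_cases h : i = j
  · subst h; simp
  · simp [h]

theorem sum_inclOp (v : PiLp 2 (fun _ : Fin 2 => H)) : ∑ j, inclOp j (v j) = v := by
  ext i
  fin_cases i <;> simp [Fin.sum_univ_two, inclOp_apply]

variable {Γ : Type*} [Group Γ]

/-- A bounded operator on `H ⊕ H` commuting with `λ ⊕ λ` commutes with `a ⊕ a`, `a ∈ λ(Γ)''`. -/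
theorem diagOp_comm {P : PiLp 2 (fun _ : Fin 2 => ell2 Γ) →L[ℂ] PiLp 2 (fun _ : Fin 2 => ell2 Γ)}
    (hP : ∀ x v, P (diagOp (leftReg x) v) = diagOp (leftReg x) (P v))
    {a : ell2 Γ →L[ℂ] ell2 Γ} (ha : a ∈ (groupVN Γ).toStarSubalgebra)
    (v : PiLp 2 (fun _ : Fin 2 => ell2 Γ)) : P (diagOp a v) = diagOp a (P v) := by
  -- Each of the four blocks of P commutes with λ(Γ), hence with `a`.
  have key : ∀ i j (w : ell2 Γ), P (inclOp j (a w)) i = a (P (inclOp j w) i) := by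
    intro i j w
    have h := mem_groupVN_iff.1 ha ((PiLp.proj 2 (fun _ : Fin 2 => ell2 Γ) i).comp
      (P.comp (inclOp j))) fun x => by
        ext1 f
        simp [← diagOp_inclOp, hP, diagOp_apply]
    simpa using congrArg (fun b => b w) h
  ext1 i
  conv_lhs => rw [← sum_inclOp v]
  conv_rhs => rw [← sum_inclOp v]
  simp [diagOp_apply, diagOp_inclOp, key]

/-- An element of `λ(Γ)''` acts on the coefficient `x ↦ ⟨λ(x) f, g⟩` independently of the choice
of `f` and `g`. -/
theorem inner_eq_of_coeff_eq {f g f' g' : ell2 Γ} (h : coeff f g = coeff f' g')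
    {a : ell2 Γ →L[ℂ] ell2 Γ} (ha : a ∈ (groupVN Γ).toStarSubalgebra) :
    ⟪g, a f⟫_ℂ = ⟪g', a f'⟫_ℂ := by
  -- K is the cyclic subspace of (f, f') under λ ⊕ λ. Equality of the two coefficients says
  -- precisely that (g, -g') is orthogonal to K, so it suffices that (a f, a f') lies in K.
  set v : PiLp 2 (fun _ : Fin 2 => ell2 Γ) := WithLp.toLp 2 ![f, f'] with hv
  set w : PiLp 2 (fun _ : Fin 2 => ell2 Γ) := WithLp.toLp 2 ![g, -g'] with hw
  set K := (Submodule.span ℂ (Set.range fun x : Γ => diagOp (leftReg x) v)).topologicalClosure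
    with hK
  have hmulD : ∀ (x y : Γ) u, diagOp (leftReg x) (diagOp (leftReg y) u) =
      diagOp (leftReg (x * y)) u := by
    intro x y u
    ext1 i
    simp [diagOp_apply, leftReg_mul]
  have hinv : ∀ x : Γ, ∀ u ∈ K, diagOp (leftReg x) u ∈ K := by
    intro x u hu
    have hle : K ≤ K.comap (diagOp (leftReg x) : _ →ₗ[ℂ] _) := by
      refine Submodule.topologicalClosure_minimal _ ?_ ?_
      · rw [Submodule.span_le]
        rintro _ ⟨y, rfl⟩
        refine Submodule.le_topologicalClosure _ (Submodule.subset_span ⟨x * y, ?_⟩)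
        exact (hmulD x y v).symm
      · exact (Submodule.isClosed_topologicalClosure _).preimage (diagOp (leftReg x)).continuous
    exact hle hu
  have hadj : ∀ (x : Γ) u u', ⟪u', diagOp (leftReg x) u⟫_ℂ = ⟪diagOp (leftReg x⁻¹) u', u⟫_ℂ := by
    intro x u u'
    simp [PiLp.inner_apply, diagOp_apply, inner_leftReg_right]
  have hinvO : ∀ x : Γ, ∀ u ∈ Kᗮ, diagOp (leftReg x) u ∈ Kᗮ := by
    intro x u hu
    rw [Submodule.mem_orthogonal] at hu ⊢
    intro u' hu'
    rw [hadj]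
    exact hu _ (hinv _ _ hu')
  have : CompleteSpace K := (Submodule.isClosed_topologicalClosure _).completeSpace_coe
  have hP : ∀ x u, K.starProjection (diagOp (leftReg x) u) =
      diagOp (leftReg x) (K.starProjection u) := by
    intro x u
    refine Submodule.eq_starProjection_of_mem_orthogonal
      (hinv x _ (K.starProjection_apply_mem u)) ?_
    rw [← map_sub]
    exact hinvO x _ (K.sub_starProjection_mem_orthogonal u)
  have hvK : v ∈ K := by
    refine Submodule.le_topologicalClosure _ (Submodule.subset_span ⟨1, ?_⟩)
    ext1 i
    simp [diagOp_apply, leftReg_one]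
  -- K reduces λ ⊕ λ, so its projection commutes with λ ⊕ λ and therefore with a ⊕ a.
  have havK : diagOp a v ∈ K := by
    have h1 := diagOp_comm (P := K.starProjection) hP ha v
    rw [Submodule.starProjection_eq_self_iff.2 hvK] at h1
    exact Submodule.starProjection_eq_self_iff.1 h1
  have hwK : ∀ u ∈ K, ⟪w, u⟫_ℂ = 0 := by
    intro u hu
    have hle : K ≤ (innerSL ℂ w).toLinearMap.ker := by
      refine Submodule.topologicalClosure_minimal _ ?_ (innerSL ℂ w).isClosed_ker
      rw [Submodule.span_le]
      rintro _ ⟨y, rfl⟩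
      have h2 := congrFun h y
      rw [coeff_eq_inner, coeff_eq_inner] at h2
      simp [PiLp.inner_apply, diagOp_apply, hv, hw, h2]
    exact hle hu
  have h3 := hwK _ havK
  simp only [PiLp.inner_apply, diagOp_apply, hv, hw, Fin.sum_univ_two] at h3
  simpa [add_neg_eq_zero] using h3

end DoubleCommutant

/-! ### Complete boundedness in terms of sesquilinear forms. -/

section Forms

variable {H : Type*} [NormedAddCommGroup H] [InnerProductSpace ℂ H]
  {ι κ : Type*} [Fintype ι] [Fintype κ]

/-- The sesquilinear form of a matrix of operators is bounded by `r`. -/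
def FormBound (a : ι → ι → H →L[ℂ] H) (r : ℝ) : Prop :=
  ∀ v w : ι → H, ‖∑ i, ∑ j, ⟪w i, a i j (v j)⟫_ℂ‖ ≤
    r * √(∑ j, ‖v j‖ ^ 2) * √(∑ i, ‖w i‖ ^ 2)

theorem norm_matrixOp_le_iff {n : ℕ} {a : Matrix (Fin n) (Fin n) (H →L[ℂ] H)} {r : ℝ}
    (hr : 0 ≤ r) : ‖matrixOp a‖ ≤ r ↔ FormBound (fun i j => a i j) r := by
  have hin : ∀ v w : PiLp 2 (fun _ : Fin n => H),
      ⟪w, matrixOp a v⟫_ℂ = ∑ i, ∑ j, ⟪w i, a i j (v j)⟫_ℂ := by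
    intro v w
    simp [PiLp.inner_apply, matrixOp_apply, inner_sum]
  constructor
  · intro h v w
    have h1 := hin (WithLp.toLp 2 v) (WithLp.toLp 2 w)
    have h2 := norm_inner_le_norm (𝕜 := ℂ) (WithLp.toLp 2 w) (matrixOp a (WithLp.toLp 2 v))
    rw [h1] at h2
    refine h2.trans ?_
    have h3 := (matrixOp a).le_of_opNorm_le h (WithLp.toLp 2 v)
    rw [mul_comm]
    rw [PiLp.norm_eq_of_L2] at h3 ⊢
    rw [PiLp.norm_eq_of_L2] at h3 ⊢
    exact mul_le_mul_of_nonneg_right h3 (Real.sqrt_nonneg _)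
  · intro h
    refine ContinuousLinearMap.opNorm_le_bound _ hr fun v => ?_
    have h1 := h v (matrixOp a v)
    have h2 := hin v (matrixOp a v)
    rw [← h2, ← PiLp.norm_eq_of_L2, ← PiLp.norm_eq_of_L2, inner_self_eq_norm_sq_to_K] at h1
    simp only [Complex.coe_algebraMap, norm_pow, Complex.norm_real, norm_norm] at h1
    rcases eq_or_lt_of_le (norm_nonneg (matrixOp a v)) with h0 | h0
    · rw [← h0]; positivity
    · rw [pow_two] at h1
      exact le_of_mul_le_mul_right h1 h0

theorem FormBound.reindex {a : ι → ι → H →L[ℂ] H} {r : ℝ} (h : FormBound a r) (e : κ ≃ ι) :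
    FormBound (fun i j => a (e i) (e j)) r := by
  intro v w
  have := h (fun i => v (e.symm i)) (fun i => w (e.symm i))
  simp only [← e.sum_comp, Equiv.symm_apply_apply] at this
  exact this

theorem FormBound.smul {a : ι → ι → H →L[ℂ] H} {r : ℝ} (h : FormBound a r) (c : ℂ) :
    FormBound (fun i j => c • a i j) (‖c‖ * r) := by
  intro v w
  have : ∑ i, ∑ j, ⟪w i, (c • a i j) (v j)⟫_ℂ = c * ∑ i, ∑ j, ⟪w i, a i j (v j)⟫_ℂ := by
    simp [Finset.mul_sum]
  rw [this, norm_mul, mul_assoc, mul_assoc, ← mul_assoc r]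
  exact mul_le_mul_of_nonneg_left (h v w) (norm_nonneg c)

theorem FormBound.mono {a : ι → ι → H →L[ℂ] H} {r s : ℝ} (h : FormBound a r) (hrs : r ≤ s) :
    FormBound a s := fun v w => (h v w).trans (by gcongr)

variable [CompleteSpace H]

theorem cbNorm_le_of_formBound {A : StarSubalgebra ℂ (H →L[ℂ] H)} {T : A →L[ℂ] A} {k : ℝ}
    (hk : 0 ≤ k)
    (h : ∀ (n : ℕ) (a : Fin n → Fin n → A), FormBound (fun i j => (a i j : H →L[ℂ] H)) 1 →
      FormBound (fun i j => (T (a i j) : H →L[ℂ] H)) k) :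
    cbNorm T ≤ ENNReal.ofReal k := by
  refine iSup_le fun n => iSup_le fun a => iSup_le fun ha => ?_
  rw [← ofReal_norm]
  refine ENNReal.ofReal_le_ofReal ((norm_matrixOp_le_iff hk).2 ?_)
  exact h n a ((norm_matrixOp_le_iff zero_le_one).1 ha)

/-- `cbNorm` only tests matrices of norm at most 1 indexed by `Fin n`; homogeneity and reindexing
remove both restrictions. The free index type is needed for matrices indexed by pairs (i, z). -/
theorem formBound_map {A : StarSubalgebra ℂ (H →L[ℂ] H)} {T : A →L[ℂ] A} {k : ℝ}
    (hk : 0 ≤ k) (hT : cbNorm T ≤ ENNReal.ofReal k) {a : ι → ι → A} {r : ℝ} (hr : 0 ≤ r)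
    (ha : FormBound (fun i j => (a i j : H →L[ℂ] H)) r) :
    FormBound (fun i j => (T (a i j) : H →L[ℂ] H)) (k * r) := by
  have unit : ∀ (n : ℕ) (a : Fin n → Fin n → A), FormBound (fun i j => (a i j : H →L[ℂ] H)) 1 →
      FormBound (fun i j => (T (a i j) : H →L[ℂ] H)) k := by
    intro n a ha
    have h1 : ‖matrixOp ((Matrix.of a).map fun x => (T x : H →L[ℂ] H))‖ₑ ≤ ENNReal.ofReal k := by
      refine le_trans ?_ hT
      refine le_iSup_of_le n (le_iSup_of_le (Matrix.of a) (le_iSup_of_le ?_ le_rfl))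
      exact (norm_matrixOp_le_iff zero_le_one).2 ha
    rw [← ofReal_norm, ENNReal.ofReal_le_ofReal_iff hk] at h1
    exact (norm_matrixOp_le_iff hk).1 h1
  have hfin : ∀ (n : ℕ) (a : Fin n → Fin n → A) (s : ℝ), 0 < s →
      FormBound (fun i j => (a i j : H →L[ℂ] H)) s →
      FormBound (fun i j => (T (a i j) : H →L[ℂ] H)) (k * s) := by
    intro n a s hs ha
    have h1 := ha.smul ((s : ℂ)⁻¹)
    have h2 : ‖(s : ℂ)⁻¹‖ * s = 1 := by
      rw [norm_inv, Complex.norm_real, Real.norm_of_nonneg hs.le, inv_mul_cancel₀ hs.ne']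
    rw [h2] at h1
    have h3 := (unit n (fun i j => (s : ℂ)⁻¹ • a i j) h1).smul (s : ℂ)
    rw [Complex.norm_real, Real.norm_of_nonneg hs.le, mul_comm] at h3
    have hs' : (s : ℂ) ≠ 0 := by exact_mod_cast hs.ne'
    simpa [smul_smul, hs'] using h3
  have e := Fintype.equivFin ι
  have hs : ∀ s, r < s → FormBound (fun i j => (T (a i j) : H →L[ℂ] H)) (k * s) := by
    intro s hs
    have h1 := (ha.mono hs.le).reindex e.symm
    have h2 := (hfin _ (fun i j => a (e.symm i) (e.symm j)) s (hr.trans_lt hs) h1).reindex e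
    simpa using h2
  intro v w
  -- Normalising by s requires s > 0, so the bound at r, possibly 0, is the limit of the bounds at s
  -- > r.
  have ht : Tendsto (fun s : ℝ => k * s * √(∑ j, ‖v j‖ ^ 2) * √(∑ i, ‖w i‖ ^ 2)) (𝓝[>] r)
      (𝓝 (k * r * √(∑ j, ‖v j‖ ^ 2) * √(∑ i, ‖w i‖ ^ 2))) := by
    refine Tendsto.mono_left ?_ nhdsWithin_le_nhds
    exact Continuous.tendsto (by fun_prop) r
  refine ge_of_tendsto ht ?_
  filter_upwards [self_mem_nhdsWithin] with s hs'
  exact hs s hs' v w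

theorem norm_le_of_cbNorm_le {A : StarSubalgebra ℂ (H →L[ℂ] H)} {T : A →L[ℂ] A} {k : ℝ}
    (hk : 0 ≤ k) (hT : cbNorm T ≤ ENNReal.ofReal k) : ‖T‖ ≤ k := by
  have conv : ∀ (b : H →L[ℂ] H) (s : ℝ), 0 ≤ s →
      (‖b‖ ≤ s ↔ FormBound (fun _ _ : Unit => b) s) := by
    intro b s hs
    constructor
    · intro h v w
      simp only [Finset.univ_unique, Finset.sum_singleton, Real.sqrt_sq (norm_nonneg _)]
      refine (norm_inner_le_norm _ _).trans ?_
      rw [mul_comm]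
      gcongr
      exact b.le_of_opNorm_le h _
    · intro h
      refine ContinuousLinearMap.opNorm_le_bound _ hs fun v => ?_
      have h1 := h (fun _ => v) (fun _ => b v)
      simp only [Finset.univ_unique, Finset.sum_singleton, Real.sqrt_sq (norm_nonneg _),
        inner_self_eq_norm_sq_to_K, Complex.coe_algebraMap, norm_pow, Complex.norm_real,
        norm_norm] at h1
      rcases eq_or_lt_of_le (norm_nonneg (b v)) with h0 | h0
      · rw [← h0]; positivity
      · rw [pow_two] at h1
        exact le_of_mul_le_mul_right h1 h0
  refine ContinuousLinearMap.opNorm_le_bound _ hk fun x => ?_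
  exact (conv _ _ (by positivity)).2 (formBound_map hk hT (a := fun _ _ : Unit => x)
    (norm_nonneg x) ((conv _ _ (norm_nonneg _)).1 le_rfl))

end Forms

/-! ### Forms on finitely supported functions. -/

section Kernels

/-- The Cauchy–Schwarz inequality for a convergent series of bounded terms. -/
theorem norm_le_of_hasSum_of_le_sqrt {S : Type*} {h : S → ℂ} {p q : S → ℝ} {X : ℂ} {P Q r : ℝ}
    (hr : 0 ≤ r) (hh : HasSum h X) (hp : ∀ s, 0 ≤ p s) (hq : ∀ s, 0 ≤ q s) (hP : HasSum p P)
    (hQ : HasSum q Q) (hb : ∀ s, ‖h s‖ ≤ r * √(p s) * √(q s)) : ‖X‖ ≤ r * √P * √Q := by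
  refine le_of_tendsto' hh.norm fun F => ?_
  calc ‖∑ s ∈ F, h s‖ ≤ ∑ s ∈ F, ‖h s‖ := norm_sum_le _ _
    _ ≤ ∑ s ∈ F, r * √(p s) * √(q s) := Finset.sum_le_sum fun s _ => hb s
    _ = r * ∑ s ∈ F, √(p s) * √(q s) := by simp [Finset.mul_sum, mul_assoc]
    _ ≤ r * (√(∑ s ∈ F, p s) * √(∑ s ∈ F, q s)) := by
        gcongr
        exact Real.sum_sqrt_mul_sqrt_le _ hp hq
    _ ≤ r * (√P * √Q) := by
        gcongr
        · exact sum_le_hasSum _ (fun s _ => hp s) hP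
        · exact sum_le_hasSum _ (fun s _ => hq s) hQ
    _ = r * √P * √Q := by ring

variable {Γ : Type*} {ι : Type*} [Fintype ι]

/-- The form given by a matrix of kernels on `Γ` is bounded by `r` on finitely supported
functions. -/
def KernelBound (m : ι → ι → Γ → Γ → ℂ) (r : ℝ) : Prop :=
  ∀ (F : Finset Γ) (ξ η : ι → Γ → ℂ),
    ‖∑ i, ∑ j, ∑ z ∈ F, ∑ y ∈ F, conj (η i z) * ξ j y * m i j z y‖ ≤
      r * √(∑ j, ∑ y ∈ F, ‖ξ j y‖ ^ 2) * √(∑ i, ∑ z ∈ F, ‖η i z‖ ^ 2)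

theorem KernelBound.mono {m : ι → ι → Γ → Γ → ℂ} {r s : ℝ} (h : KernelBound m r) (hrs : r ≤ s) :
    KernelBound m s := fun F ξ η => (h F ξ η).trans (by gcongr)

theorem KernelBound.add {m m' : ι → ι → Γ → Γ → ℂ} {r s : ℝ} (h : KernelBound m r)
    (h' : KernelBound m' s) : KernelBound (fun i j z y => m i j z y + m' i j z y) (r + s) := by
  intro F ξ η
  simp only [mul_add, Finset.sum_add_distrib, add_mul]
  exact (norm_add_le _ _).trans (add_le_add (h F ξ η) (h' F ξ η))

theorem KernelBound.smul {m : ι → ι → Γ → Γ → ℂ} {r : ℝ} (h : KernelBound m r) (c : ℂ) :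
    KernelBound (fun i j z y => c * m i j z y) (‖c‖ * r) := by
  intro F ξ η
  have : ∑ i, ∑ j, ∑ z ∈ F, ∑ y ∈ F, conj (η i z) * ξ j y * (c * m i j z y) =
      c * ∑ i, ∑ j, ∑ z ∈ F, ∑ y ∈ F, conj (η i z) * ξ j y * m i j z y := by
    simp only [Finset.mul_sum]
    refine Finset.sum_congr rfl fun i _ => Finset.sum_congr rfl fun j _ =>
      Finset.sum_congr rfl fun z _ => Finset.sum_congr rfl fun y _ => by ring
  rw [this, norm_mul, mul_assoc, mul_assoc, ← mul_assoc r]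
  exact mul_le_mul_of_nonneg_left (h F ξ η) (norm_nonneg c)

theorem inner_sum_delta (a : ell2 Γ →L[ℂ] ell2 Γ) (F : Finset Γ) (ξ η : Γ → ℂ) :
    ⟪∑ z ∈ F, η z • delta z, a (∑ y ∈ F, ξ y • delta y)⟫_ℂ =
      ∑ z ∈ F, ∑ y ∈ F, conj (η z) * ξ y * a (delta y) z := by
  rw [map_sum, sum_inner]
  refine Finset.sum_congr rfl fun z _ => ?_
  rw [inner_sum]
  refine Finset.sum_congr rfl fun y _ => ?_
  rw [map_smul, inner_smul_left, inner_smul_right, inner_delta_left, mul_assoc]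

/-- Finitely supported vectors are dense, and truncating a vector does not increase its norm. A
`KernelBound` also makes sense for a kernel not yet known to come from operators, such as a Schur
product. -/
theorem formBound_iff_kernelBound {a : ι → ι → ell2 Γ →L[ℂ] ell2 Γ} {r : ℝ} (hr : 0 ≤ r) :
    FormBound a r ↔ KernelBound (fun i j z y => a i j (delta y) z) r := by
  constructor
  · intro h F ξ η
    have := h (fun j => ∑ y ∈ F, ξ j y • delta y) (fun i => ∑ z ∈ F, η i z • delta z)
    simpa only [inner_sum_delta, norm_sq_sum_smul_delta] using this
  · intro h v w
    have ht : Tendsto (fun F : Finset Γ => ∑ i, ∑ j, ⟪∑ z ∈ F, w i z • delta z,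
        a i j (∑ y ∈ F, v j y • delta y)⟫_ℂ) atTop (𝓝 (∑ i, ∑ j, ⟪w i, a i j (v j)⟫_ℂ)) :=
      tendsto_finsetSum _ fun i _ => tendsto_finsetSum _ fun j _ =>
        (tendsto_sum_smul_delta (w i)).inner
          (((a i j).continuous.tendsto _).comp (tendsto_sum_smul_delta (v j)))
    refine le_of_tendsto' ht.norm fun F => ?_
    simp only [inner_sum_delta]
    refine (h F (fun j => v j) (fun i => w i)).trans ?_
    gcongr with j _ i _
    · exact sum_le_hasSum _ (fun _ _ => by positivity) (hasSum_norm_sq (v j))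
    · exact sum_le_hasSum _ (fun _ _ => by positivity) (hasSum_norm_sq (w i))

end Kernels

theorem hasSum_of_eq {S : Type*} {f g : S → ℂ} {a b : ℂ} (h : HasSum f a)
    (hfg : ∀ s, g s = f s) (hab : b = a) : HasSum g b := by
  obtain rfl : g = f := funext hfg
  rwa [hab]

theorem sum_prod_coe_sort {Γ ι M : Type*} [Fintype ι] [AddCommMonoid M] (F : Finset Γ)
    (G : ι → Γ → M) : ∑ p : ι × F, G p.1 p.2 = ∑ i, ∑ z ∈ F, G i z := by
  rw [Fintype.sum_prod_type]
  exact Finset.sum_congr rfl fun i _ => Finset.sum_coe_sort F (G i)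

theorem sum_sum_prod_coe_sort {Γ ι M : Type*} [Fintype ι] [AddCommMonoid M] (F : Finset Γ)
    (G : ι → ι → Γ → Γ → M) : ∑ p : ι × F, ∑ q : ι × F, G p.1 q.1 p.2 q.2 =
      ∑ i, ∑ j, ∑ z ∈ F, ∑ y ∈ F, G i j z y := by
  have h : ∀ p : ι × F, ∑ q : ι × F, G p.1 q.1 p.2 q.2 =
      ∑ j, ∑ y ∈ F, G p.1 j p.2 y := fun p => sum_prod_coe_sort F fun j y => G p.1 j p.2 y
  rw [Finset.sum_congr rfl fun p _ => h p,
    sum_prod_coe_sort F fun i z => ∑ j, ∑ y ∈ F, G i j z y]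
  exact Finset.sum_congr rfl fun i _ => Finset.sum_comm

/-! ### Schur multipliers with kernel φ(z y⁻¹). -/

section Schur

variable {Γ : Type*} [Group Γ]

/-- The Schur multiplier with kernel `φ(z y⁻¹)` is completely bounded on `λ(Γ)''` with norm at
most `C`, expressed by forms on finitely supported functions. -/
def SchurBound (φ : Γ → ℂ) (C : ℝ) : Prop :=
  ∀ (n : ℕ) (a : Fin n → Fin n → ell2 Γ →L[ℂ] ell2 Γ) (r : ℝ), 0 ≤ r →
    (∀ i j, a i j ∈ (groupVN Γ).toStarSubalgebra) → FormBound a r →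
    KernelBound (fun i j z y => φ (z * y⁻¹) * a i j (delta y) z) (C * r)

theorem SchurBound.mono {φ : Γ → ℂ} {C D : ℝ} (h : SchurBound φ C) (hCD : C ≤ D) :
    SchurBound φ D := fun n a r hr hm ha => (h n a r hr hm ha).mono (by gcongr)

theorem SchurBound.add {φ ψ : Γ → ℂ} {C D : ℝ} (h : SchurBound φ C) (h' : SchurBound ψ D) :
    SchurBound (φ + ψ) (C + D) := fun n a r hr hm ha => by
  simpa only [Pi.add_apply, add_mul] using (h n a r hr hm ha).add (h' n a r hr hm ha)

theorem SchurBound.smul {φ : Γ → ℂ} {C : ℝ} (h : SchurBound φ C) (c : ℂ) :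
    SchurBound (c • φ) (‖c‖ * C) := fun n a r hr hm ha => by
  simpa only [Pi.smul_apply, smul_eq_mul, mul_assoc] using (h n a r hr hm ha).smul c

theorem SchurBound.neg {φ : Γ → ℂ} {C : ℝ} (h : SchurBound φ C) : SchurBound (-φ) C := by
  simpa using h.smul (-1)

/-- `T` is the restriction of the Schur multiplier with kernel `φ(z y⁻¹)`. -/
def HasSchurEntries {A : StarSubalgebra ℂ (ell2 Γ →L[ℂ] ell2 Γ)} (T : A →L[ℂ] A)
    (φ : Γ → ℂ) : Prop :=
  ∀ (a : A) (z y : Γ), (T a : ell2 Γ →L[ℂ] ell2 Γ) (delta y) z =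
    φ (z * y⁻¹) * (a : ell2 Γ →L[ℂ] ell2 Γ) (delta y) z

/-- A bound tested on all of λ(Γ)'' restricts to any subalgebra, so one estimate serves C*_r(Γ) and
the von Neumann algebra. -/
theorem cbNorm_le_of_schurBound {A : StarSubalgebra ℂ (ell2 Γ →L[ℂ] ell2 Γ)}
    (hA : A ≤ (groupVN Γ).toStarSubalgebra) {T : A →L[ℂ] A} {φ : Γ → ℂ}
    (hT : HasSchurEntries T φ) {C : ℝ} (hC : 0 ≤ C) (hφ : SchurBound φ C) :
    cbNorm T ≤ ENNReal.ofReal C := by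
  refine cbNorm_le_of_formBound hC fun n a ha => ?_
  have h := hφ n (fun i j => a i j) 1 zero_le_one (fun i j => hA (a i j).2) ha
  rw [formBound_iff_kernelBound hC]
  simp only [hT _ _ _]
  simpa using h

/-- The coefficient of δ_y and δ_z is the indicator of z y⁻¹, so multiplying it by φ merely scales
it by φ(z y⁻¹). -/
theorem hasSchurEntries_of_isTransposedMultiplication {φ : Γ → ℂ}
    {S : (groupVN Γ).toStarSubalgebra →L[ℂ] (groupVN Γ).toStarSubalgebra}
    (hS : IsTransposedMultiplication φ S) : HasSchurEntries S φ := by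
  intro a z y
  have h : φ * coeff (delta y) (delta z) = coeff (φ (z * y⁻¹) • delta y) (delta z) := by
    ext x
    simp only [Pi.mul_apply, coeff_eq_inner, map_smul, leftReg_delta, inner_smul_right,
      inner_delta_left, delta_apply]
    split_ifs with hx
    · rw [hx, mul_inv_cancel_right]
    · simp
  have := hS _ _ _ _ h a
  simpa [inner_delta_left] using this

theorem schurBound_of_isTransposedMultiplication {φ : Γ → ℂ} {C : ℝ} (hC : 0 ≤ C)
    {S : (groupVN Γ).toStarSubalgebra →L[ℂ] (groupVN Γ).toStarSubalgebra}
    (hS : IsTransposedMultiplication φ S) (hcb : cbNorm S ≤ ENNReal.ofReal C) :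
    SchurBound φ C := by
  intro n a r hr hm ha
  have h := formBound_map hC hcb (a := fun i j => ⟨a i j, hm i j⟩) hr ha
  rw [formBound_iff_kernelBound (mul_nonneg hC hr)] at h
  simpa only [hasSchurEntries_of_isTransposedMultiplication hS _ _ _] using h

/-- The substitution s = z t in the inner product separates the variables: the kernel at (z, y)
becomes a Gram kernel of a vector depending on z and one depending on y. -/
theorem hasSum_coeff (f g : ell2 Γ) (z y : Γ) :
    HasSum (fun t => conj (g (z * t)) * f (y * t)) (coeff f g (z * y⁻¹)) := by
  have h := lp.hasSum_inner (𝕜 := ℂ) g (leftReg (z * y⁻¹) f)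
  rw [← (Equiv.mulLeft z).hasSum_iff] at h
  refine hasSum_of_eq h (fun t => ?_) rfl
  simp [leftReg_apply, mul_assoc, mul_comm]

theorem hasSum_sum_norm_sq_translate {ι : Type*} [Fintype ι] (f : ell2 Γ) (F : Finset Γ)
    (ξ : ι → Γ → ℂ) :
    HasSum (fun t => ∑ j, ∑ y ∈ F, ‖ξ j y * f (y * t)‖ ^ 2)
      ((∑ j, ∑ y ∈ F, ‖ξ j y‖ ^ 2) * ‖f‖ ^ 2) := by
  simp only [norm_mul, mul_pow]
  rw [Finset.sum_mul]
  simp only [Finset.sum_mul]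
  refine hasSum_sum fun j _ => hasSum_sum fun y _ => HasSum.mul_left _ ?_
  exact (Equiv.mulLeft y).hasSum_iff.2 (hasSum_norm_sq f)

/-- Coefficients of the regular representation are completely bounded Schur multipliers. -/
theorem schurBound_coeff (f g : ell2 Γ) : SchurBound (coeff f g) (‖f‖ * ‖g‖) := by
  intro n a r hr _ ha F ξ η
  rw [formBound_iff_kernelBound hr] at ha
  -- For each t the summand is the form of `a` at the vectors ξ(y) f(y t) and η(z) g(z t);
  -- Cauchy–Schwarz over t then yields ‖f‖ ‖g‖.
  have hh : HasSum (fun t => ∑ i, ∑ j, ∑ z ∈ F, ∑ y ∈ F,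
      conj (η i z * g (z * t)) * (ξ j y * f (y * t)) * a i j (delta y) z)
      (∑ i, ∑ j, ∑ z ∈ F, ∑ y ∈ F,
        conj (η i z) * ξ j y * (coeff f g (z * y⁻¹) * a i j (delta y) z)) := by
    refine hasSum_sum fun i _ => hasSum_sum fun j _ => hasSum_sum fun z _ =>
      hasSum_sum fun y _ => ?_
    refine hasSum_of_eq (((hasSum_coeff f g z y).mul_left (conj (η i z) * ξ j y)).mul_right
      (a i j (delta y) z)) (fun t => ?_) (by ring)
    rw [map_mul]
    ring
  have key := norm_le_of_hasSum_of_le_sqrt hr hh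
    (fun t => Finset.sum_nonneg fun j _ => Finset.sum_nonneg fun y _ => by positivity)
    (fun t => Finset.sum_nonneg fun j _ => Finset.sum_nonneg fun y _ => by positivity)
    (hasSum_sum_norm_sq_translate f F ξ) (hasSum_sum_norm_sq_translate g F η)
    (fun t => ha F (fun j y => ξ j y * f (y * t)) (fun i z => η i z * g (z * t)))
  refine key.trans (le_of_eq ?_)
  rw [Real.sqrt_mul' _ (sq_nonneg _), Real.sqrt_mul' _ (sq_nonneg _),
    Real.sqrt_sq (norm_nonneg _), Real.sqrt_sq (norm_nonneg _)]
  ring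

/-- Twisting a matrix of operators by the regular representation does not increase the norm. -/
theorem norm_sum_inner_twist_le {ι : Type*} [Fintype ι] {m : ι → ι → Γ → Γ → ℂ} {r : ℝ}
    (hr : 0 ≤ r) (hm : KernelBound m r) (F : Finset Γ) (V W : ι → Γ → ell2 Γ) :
    ‖∑ i, ∑ j, ∑ z ∈ F, ∑ y ∈ F, ⟪W i z, (m i j z y • leftReg (z * y⁻¹)) (V j y)⟫_ℂ‖ ≤
      r * √(∑ j, ∑ y ∈ F, ‖V j y‖ ^ 2) * √(∑ i, ∑ z ∈ F, ‖W i z‖ ^ 2) := by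
  -- Fell absorption: in the coordinates V_y(y s), W_z(z s) the twisted matrix acts, for each s
  -- separately, as the untwisted kernel m.
  have hh : HasSum (fun s => ∑ i, ∑ j, ∑ z ∈ F, ∑ y ∈ F,
      conj (W i z (z * s)) * V j y (y * s) * m i j z y)
      (∑ i, ∑ j, ∑ z ∈ F, ∑ y ∈ F, ⟪W i z, (m i j z y • leftReg (z * y⁻¹)) (V j y)⟫_ℂ) := by
    refine hasSum_sum fun i _ => hasSum_sum fun j _ => hasSum_sum fun z _ =>
      hasSum_sum fun y _ => ?_
    refine hasSum_of_eq ((hasSum_coeff (V j y) (W i z) z y).mul_right (m i j z y))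
      (fun _ => rfl) ?_
    rw [coeff_eq_inner, mul_comm, ← inner_smul_right]
    rfl
  have hsum : ∀ V : ι → Γ → ell2 Γ, HasSum (fun s => ∑ j, ∑ y ∈ F, ‖V j y (y * s)‖ ^ 2)
      (∑ j, ∑ y ∈ F, ‖V j y‖ ^ 2) := fun V =>
    hasSum_sum fun j _ => hasSum_sum fun y _ =>
      (Equiv.mulLeft y).hasSum_iff.2 (hasSum_norm_sq (V j y))
  exact norm_le_of_hasSum_of_le_sqrt hr hh
    (fun t => Finset.sum_nonneg fun j _ => Finset.sum_nonneg fun y _ => by positivity)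
    (fun t => Finset.sum_nonneg fun j _ => Finset.sum_nonneg fun y _ => by positivity)
    (hsum V) (hsum W) (fun s => hm F (fun j y => V j y (y * s)) (fun i z => W i z (z * s)))

/-- The function `x ↦ τ(λ(x)* T λ(x))` attached to a map `T` on an operator algebra containing
the regular representation. -/
def symbol {A : StarSubalgebra ℂ (ell2 Γ →L[ℂ] ell2 Γ)} (hA : ∀ x, leftReg x ∈ A)
    (T : A →L[ℂ] A) (x : Γ) : ℂ :=
  (T ⟨leftReg x, hA x⟩ : ell2 Γ →L[ℂ] ell2 Γ) (delta 1) x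

/-- Haagerup's averaging argument. The block matrix with entries a(z, y) λ(z y⁻¹) has form bound r
by Fell absorption. Applying T entrywise costs a factor k, and compressing block (z, y) to its own
entry at δ_z, δ_y leaves φ(z y⁻¹) a(z, y), with φ the symbol. -/
theorem schurBound_symbol {A : StarSubalgebra ℂ (ell2 Γ →L[ℂ] ell2 Γ)}
    (hA : ∀ x, leftReg x ∈ A) (hA' : A ≤ (groupVN Γ).toStarSubalgebra) {T : A →L[ℂ] A} {k : ℝ}
    (hk : 0 ≤ k) (hT : cbNorm T ≤ ENNReal.ofReal k) : SchurBound (symbol hA T) k := by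
  classical
  intro n a r hr _ ha F ξ η
  rw [formBound_iff_kernelBound hr] at ha
  set b : Fin n × F → Fin n × F → A := fun p q =>
    a p.1 q.1 (delta (q.2 : Γ)) (p.2 : Γ) • ⟨leftReg ((p.2 : Γ) * (q.2 : Γ)⁻¹), hA _⟩ with hb
  have hbound : FormBound (fun p q => (b p q : ell2 Γ →L[ℂ] ell2 Γ)) r := by
    intro v w
    -- Extension by zero from F to Γ, matching the index conventions of the twisting lemma.
    set V : Fin n → Γ → ell2 Γ := fun j y => if hy : y ∈ F then v (j, ⟨y, hy⟩) else 0 with hV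
    set W : Fin n → Γ → ell2 Γ := fun i z => if hz : z ∈ F then w (i, ⟨z, hz⟩) else 0 with hW
    have hv : v = fun p => V p.1 p.2 := by ext1 p; simp [hV]
    have hw : w = fun p => W p.1 p.2 := by ext1 p; simp [hW]
    have h := norm_sum_inner_twist_le hr ha F V W
    rw [← sum_sum_prod_coe_sort F fun i j z y => ⟪W i z,
        (a i j (delta y) z • leftReg (z * y⁻¹)) (V j y)⟫_ℂ,
      ← sum_prod_coe_sort F fun i z => ‖V i z‖ ^ 2,
      ← sum_prod_coe_sort F fun i z => ‖W i z‖ ^ 2] at h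
    rw [hv, hw]
    exact h
  -- These test vectors carry out the compression: the component indexed by z is a multiple of δ_z.
  have h := formBound_map hk hT hr hbound (fun p => ξ p.1 p.2 • delta (p.2 : Γ))
    (fun p => η p.1 p.2 • delta (p.2 : Γ))
  have hterm : ∀ p q : Fin n × F, ⟪η p.1 p.2 • delta (p.2 : Γ),
      (T (b p q) : ell2 Γ →L[ℂ] ell2 Γ) (ξ q.1 q.2 • delta (q.2 : Γ))⟫_ℂ =
      conj (η p.1 p.2) * ξ q.1 q.2 * (symbol hA T (p.2 * (q.2 : Γ)⁻¹) *
        a p.1 q.1 (delta (q.2 : Γ)) (p.2 : Γ)) := by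
    intro p q
    have hsym : (T ⟨leftReg ((p.2 : Γ) * (q.2 : Γ)⁻¹), hA _⟩ : ell2 Γ →L[ℂ] ell2 Γ)
        (delta (q.2 : Γ)) (p.2 : Γ) = symbol hA T (p.2 * (q.2 : Γ)⁻¹) :=
      groupVN_entry (hA' (T _).2) _ _
    have hTb : (T (b p q) : ell2 Γ →L[ℂ] ell2 Γ) = a p.1 q.1 (delta (q.2 : Γ)) (p.2 : Γ) •
        (T ⟨leftReg ((p.2 : Γ) * (q.2 : Γ)⁻¹), hA _⟩ : ell2 Γ →L[ℂ] ell2 Γ) := by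
      rw [hb, map_smul]
      rfl
    rw [← hsym, hTb, map_smul, inner_smul_left, inner_smul_right, smul_apply, inner_smul_right,
      inner_delta_left]
    ring
  simp only [hterm, norm_smul, norm_delta, mul_one] at h
  rw [sum_sum_prod_coe_sort F fun i j z y => conj (η i z) * ξ j y * (symbol hA T (z * y⁻¹) *
        a i j (delta y) z), sum_prod_coe_sort F fun i z => ‖ξ i z‖ ^ 2,
      sum_prod_coe_sort F fun i z => ‖η i z‖ ^ 2] at h
  exact h

end Schur

/-! ### Multipliers with square summable symbol. -/

section SquareSummable

theorem sum_norm_mul_le {Γ : Type*} (φ f : ell2 Γ) (F : Finset Γ) :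
    ∑ x ∈ F, ‖φ x * f x‖ ≤ ‖φ‖ * ‖f‖ := by
  simp only [norm_mul]
  refine (Real.sum_mul_le_sqrt_mul_sqrt F _ _).trans ?_
  have h : ∀ g : ell2 Γ, √(∑ x ∈ F, ‖g x‖ ^ 2) ≤ ‖g‖ := fun g =>
    Real.sqrt_le_iff.2 ⟨norm_nonneg _, sum_le_hasSum _ (fun _ _ => by positivity)
      (hasSum_norm_sq g)⟩
  exact mul_le_mul (h φ) (h f) (Real.sqrt_nonneg _) (norm_nonneg _)

theorem memℓp_bounded_mul {Γ : Type*} {c u : Γ → ℂ} {M : ℝ} (hc : ∀ x, ‖c x‖ ≤ M)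
    (hu : Memℓp u 2) : Memℓp (fun x => c x * u x) 2 := by
  rw [memℓp_two_iff] at hu ⊢
  refine Summable.of_nonneg_of_le (fun _ => by positivity) (fun x => ?_) (hu.mul_left (M ^ 2))
  rw [norm_mul, mul_pow]
  gcongr
  exact hc x

variable {Γ : Type*} [Group Γ]

/-- The operator `∑ φ(x) â(x) λ(x)`, where `â = a δ₁` are the Fourier coefficients of `a`. -/
def multSum (φ : ell2 Γ) (a : ell2 Γ →L[ℂ] ell2 Γ) : ell2 Γ →L[ℂ] ell2 Γ :=
  ∑' x, (φ x * a (delta 1) x) • leftReg x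

theorem norm_smul_leftReg_le (c : ℂ) (x : Γ) : ‖c • leftReg x‖ ≤ ‖c‖ := by
  rw [norm_smul]
  exact mul_le_of_le_one_right (norm_nonneg _) (norm_leftReg_le x)

theorem sum_norm_multSum_le (φ : ell2 Γ) (a : ell2 Γ →L[ℂ] ell2 Γ) (F : Finset Γ) :
    ∑ x ∈ F, ‖(φ x * a (delta 1) x) • leftReg x‖ ≤ ‖φ‖ * ‖a‖ := by
  refine (Finset.sum_le_sum fun x _ => norm_smul_leftReg_le _ x).trans ?_
  refine (sum_norm_mul_le φ (a (delta 1)) F).trans ?_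
  gcongr
  simpa [norm_delta] using a.le_opNorm (delta 1)

theorem summable_norm_multSum (φ : ell2 Γ) (a : ell2 Γ →L[ℂ] ell2 Γ) :
    Summable fun x => ‖(φ x * a (delta 1) x) • leftReg x‖ :=
  summable_of_sum_le (fun _ => norm_nonneg _) (sum_norm_multSum_le φ a)

theorem hasSum_multSum (φ : ell2 Γ) (a : ell2 Γ →L[ℂ] ell2 Γ) :
    HasSum (fun x => (φ x * a (delta 1) x) • leftReg x) (multSum φ a) :=
  (summable_norm_multSum φ a).of_norm.hasSum

theorem norm_multSum_le (φ : ell2 Γ) (a : ell2 Γ →L[ℂ] ell2 Γ) :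
    ‖multSum φ a‖ ≤ ‖φ‖ * ‖a‖ :=
  (norm_tsum_le_tsum_norm (summable_norm_multSum φ a)).trans
    ((summable_norm_multSum φ a).tsum_le_of_sum_le (sum_norm_multSum_le φ a))

variable {A : StarSubalgebra ℂ (ell2 Γ →L[ℂ] ell2 Γ)}

/-- Both φ and a δ₁ are in ℓ²(Γ), so the defining series converges absolutely in operator norm and
stays in any norm closed algebra containing λ(Γ). -/
theorem multSum_mem (hA : ∀ x, leftReg x ∈ A) (hcl : IsClosed (A : Set (ell2 Γ →L[ℂ] ell2 Γ)))
    (φ : ell2 Γ) (a : ell2 Γ →L[ℂ] ell2 Γ) : multSum φ a ∈ A :=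
  hcl.mem_of_tendsto (hasSum_multSum φ a)
    (Eventually.of_forall fun _ => sum_mem fun x _ => A.smul_mem (hA x) _)

/-- The multiplication operator `λ(x) ↦ φ(x) λ(x)` with square summable symbol. -/
def multOp (hA : ∀ x, leftReg x ∈ A) (hcl : IsClosed (A : Set (ell2 Γ →L[ℂ] ell2 Γ)))
    (φ : ell2 Γ) : A →L[ℂ] A :=
  LinearMap.mkContinuous
    { toFun := fun a => ⟨multSum φ a, multSum_mem hA hcl φ a⟩
      map_add' := fun a b => Subtype.ext <| by
        refine (hasSum_multSum φ _).unique ?_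
        convert (hasSum_multSum φ a).add (hasSum_multSum φ b) using 2 with x
        · rw [← add_smul, ← mul_add]
          rfl
        · rfl
      map_smul' := fun c a => Subtype.ext <| by
        refine (hasSum_multSum φ _).unique ?_
        convert (hasSum_multSum φ a).const_smul c using 2 with x
        · rw [smul_smul, mul_left_comm]
          rfl
        · rfl } ‖φ‖ fun a => norm_multSum_le φ a

variable (hA : ∀ x, leftReg x ∈ A) (hcl : IsClosed (A : Set (ell2 Γ →L[ℂ] ell2 Γ)))

theorem coe_multOp (φ : ell2 Γ) (a : A) :
    (multOp hA hcl φ a : ell2 Γ →L[ℂ] ell2 Γ) = multSum φ a := rfl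

theorem hasSum_inner_multSum (φ : ell2 Γ) (a : ell2 Γ →L[ℂ] ell2 Γ) (f g : ell2 Γ) :
    HasSum (fun x => φ x * a (delta 1) x * coeff f g x) ⟪g, multSum φ a f⟫_ℂ := by
  have h := ((hasSum_multSum φ a).mapL (ContinuousLinearMap.apply ℂ (ell2 Γ) f)).mapL
    (innerSL ℂ g)
  refine hasSum_of_eq h (fun x => ?_) rfl
  simp [coeff_eq_inner]

theorem multSum_delta (φ : ell2 Γ) (a : ell2 Γ →L[ℂ] ell2 Γ) (z y : Γ) :
    multSum φ a (delta y) z = φ (z * y⁻¹) * a (delta 1) (z * y⁻¹) := by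
  rw [← inner_delta_left]
  refine (hasSum_inner_multSum φ a (delta y) (delta z)).unique ?_
  have h := hasSum_single (f := fun x => φ x * a (delta 1) x * coeff (delta y) (delta z) x)
    (z * y⁻¹) fun x hx => by
      have : z ≠ x * y := fun h => hx (by rw [h, mul_inv_cancel_right])
      simp [coeff_eq_inner, leftReg_delta, inner_delta_left, delta_apply, this]
  simpa [coeff_eq_inner, leftReg_delta, inner_delta_left, delta_apply, norm_delta] using h

theorem hasSchurEntries_multOp (hA' : A ≤ (groupVN Γ).toStarSubalgebra) (φ : ell2 Γ) :
    HasSchurEntries (multOp hA hcl φ) φ := by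
  intro a z y
  rw [coe_multOp, multSum_delta, ← groupVN_entry (hA' a.2)]

theorem multOp_leftReg (φ : ell2 Γ) (x : Γ) :
    multOp hA hcl φ ⟨leftReg x, hA x⟩ = φ x • ⟨leftReg x, hA x⟩ := by
  refine Subtype.ext (clm_ext_entries fun z y => ?_)
  rw [coe_multOp, multSum_delta]
  change _ = φ x * (leftReg x (delta y) : ell2 Γ) z
  rw [leftReg_delta, leftReg_delta, delta_apply, delta_apply, mul_one]
  by_cases h : z = x * y
  · simp [h]
  · have h' : z * y⁻¹ ≠ x := fun h' => h (mul_inv_eq_iff_eq_mul.1 h')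
    simp [h, h']

/-- Coefficients are bounded, so the product is square summable and therefore again in A(Γ). -/
theorem isMultiplier_of_memℓp (φ : ell2 Γ) : IsMultiplier (φ : Γ → ℂ) := by
  rintro _ ⟨f, g, rfl⟩
  refine mem_fourierAlgebra_of_memℓp ?_
  convert memℓp_bounded_mul (norm_coeff_le f g) (lp.memℓp φ) using 1
  ext x
  exact mul_comm _ _

/-- The value on φψ does not depend on the representing vectors, so f' and g' may be replaced by
k(x) = (φψ)(x⁻¹) and δ₁. Both sides then become the sum of φ(x) â(x) ψ(x). -/
theorem isTransposedMultiplication_multOp (φ : ell2 Γ) :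
    IsTransposedMultiplication φ (multOp leftReg_mem_groupVN isClosed_groupVN φ) := by
  intro f g f' g' h a
  have hmem : Memℓp (fun x => (φ : Γ → ℂ) x⁻¹ * coeff f g x⁻¹) 2 := by
    have := memℓp_comp_inv (memℓp_bounded_mul (norm_coeff_le f g) (lp.memℓp φ))
    simpa only [mul_comm] using this
  set k : ell2 Γ := ⟨_, hmem⟩ with hk
  have hcoeff : coeff k (delta 1) = coeff f' g' := by
    rw [← h]
    ext x
    rw [coeff_delta_one]
    simp [hk]
  rw [← inner_eq_of_coeff_eq hcoeff a.2, coe_multOp]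
  refine (hasSum_inner_multSum φ a f g).unique ?_
  have h1 := ((hasSum_delta k).mapL (a : ell2 Γ →L[ℂ] ell2 Γ)).mapL (innerSL ℂ (delta (1 : Γ)))
  rw [← (Equiv.inv Γ).hasSum_iff] at h1
  refine hasSum_of_eq h1 (fun x => ?_) rfl
  have h2 := groupVN_entry a.2 1 x⁻¹
  simp only [one_mul, inv_inv] at h2
  simp [inner_delta_left, h2, hk]
  ring

/-- A square summable function is a completely bounded multiplier of `A(Γ)` as soon as its
Schur multiplier is completely bounded, with the same bound. -/
theorem multiplierCBNorm_le {φ : ell2 Γ} {k : ℝ} (hk : 0 ≤ k) (h : SchurBound (φ : Γ → ℂ) k) :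
    multiplierCBNorm (φ : Γ → ℂ) ≤ ENNReal.ofReal k :=
  iInf₂_le_of_le (multOp leftReg_mem_groupVN isClosed_groupVN φ)
    ⟨isMultiplier_of_memℓp φ, isTransposedMultiplication_multOp φ⟩
    (cbNorm_le_of_schurBound le_rfl (hasSchurEntries_multOp _ _ le_rfl φ) hk h)

theorem multOp_eq_sum {φ : ell2 Γ} {F : Finset Γ} (hF : ∀ x ∉ F, φ x = 0) (a : A) :
    multOp hA hcl φ a = ∑ x ∈ F, (φ x * (a : ell2 Γ →L[ℂ] ell2 Γ) (delta 1) x) •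
      (⟨leftReg x, hA x⟩ : A) := by
  refine Subtype.ext ?_
  rw [coe_multOp, multSum, tsum_eq_sum (s := F) fun x hx => by simp [hF x hx]]
  simp

theorem isFiniteRank_multOp {φ : ell2 Γ} {F : Finset Γ} (hF : ∀ x ∉ F, φ x = 0) :
    IsFiniteRank (multOp hA hcl φ) := by
  classical
  have hle : LinearMap.range (multOp hA hcl φ : A →ₗ[ℂ] A) ≤
      Submodule.span ℂ (F.image fun x => (⟨leftReg x, hA x⟩ : A) : Set A) := by
    rintro _ ⟨a, rfl⟩
    change multOp hA hcl φ a ∈ _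
    rw [multOp_eq_sum hA hcl hF]
    exact sum_mem fun x hx => Submodule.smul_mem _ _
      (Submodule.subset_span (by exact_mod_cast Finset.mem_image_of_mem _ hx))
  exact Submodule.finiteDimensional_of_le hle

end SquareSummable

/-! ### σ-weak continuity of finitely supported multipliers. -/

section Predual

theorem mem_predual_of_inner {H : Type*} [NormedAddCommGroup H] [InnerProductSpace ℂ H]
    [CompleteSpace H] {M : VonNeumannAlgebra H} {ω : M.toStarSubalgebra →L[ℂ] ℂ} (ξ η : H)
    (h : ∀ a, ω a = ⟪η, (a : H →L[ℂ] H) ξ⟫_ℂ) : ω ∈ predual M := by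
  refine ⟨fun n => if n = 0 then ξ else 0, fun n => if n = 0 then η else 0, ?_, ?_, fun a => ?_⟩
  · exact summable_of_hasFiniteSupport ((Set.finite_singleton 0).subset fun n hn => by
      by_contra h0; simp_all)
  · exact summable_of_hasFiniteSupport ((Set.finite_singleton 0).subset fun n hn => by
      by_contra h0; simp_all)
  · rw [tsum_eq_single 0 fun n hn => by simp [hn], h]
    simp

variable {Γ : Type*} [Group Γ]

theorem isSigmaWeaklyContinuous_multOp {φ : ell2 Γ} {F : Finset Γ} (hF : ∀ x ∉ F, φ x = 0) :
    IsSigmaWeaklyContinuous (M := groupVN Γ)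
      (multOp leftReg_mem_groupVN isClosed_groupVN φ) := by
  set T := multOp leftReg_mem_groupVN isClosed_groupVN φ with hT
  -- T sees `a` only through finitely many Fourier coefficients ⟨a δ₁, δₓ⟩, so composing ω with T
  -- gives a vector functional at δ₁.
  have key : ∀ ω ∈ predual (groupVN Γ), ω.comp T ∈ predual (groupVN Γ) := by
    intro ω _
    refine mem_predual_of_inner (delta 1)
      (∑ x ∈ F, conj (φ x * ω ⟨leftReg x, leftReg_mem_groupVN x⟩) • delta x) fun a => ?_
    rw [ContinuousLinearMap.comp_apply, hT, multOp_eq_sum _ _ hF, map_sum, sum_inner]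
    refine Finset.sum_congr rfl fun x _ => ?_
    rw [map_smul, inner_smul_left, inner_delta_left, smul_eq_mul, Complex.conj_conj]
    ring
  refine continuous_iInf_rng.2 fun ω => continuous_iInf_rng.2 fun hω =>
    continuous_induced_rng.2 ?_
  exact continuous_iInf_dom (i := ω.comp T) (continuous_iInf_dom (i := key ω hω)
    continuous_induced_dom)

end Predual

/-! ### Convergence of bounded nets tested on dense sets. -/

section Convergence

/-- A bounded family of operators converging to zero on a set converges to zero on its closed
linear span. -/
theorem tendsto_zero_of_mem_closure_span {E G ι : Type*} [NormedAddCommGroup E] [NormedSpace ℂ E]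
    [NormedAddCommGroup G] [NormedSpace ℂ G] {l : Filter ι} {L : ι → E →L[ℂ] G} {R : ℝ}
    (hL : ∀ α, ‖L α‖ ≤ R) {s : Set E} (hs : ∀ v ∈ s, Tendsto (fun α => L α v) l (𝓝 0)) {v : E}
    (hv : v ∈ closure (Submodule.span ℂ s : Set E)) : Tendsto (fun α => L α v) l (𝓝 0) := by
  have hspan : ∀ w ∈ Submodule.span ℂ s, Tendsto (fun α => L α w) l (𝓝 0) := by
    intro w hw
    induction hw using Submodule.span_induction with
    | mem w hw => exact hs w hw
    | zero => simpa using tendsto_const_nhds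
    | add w w' _ _ h h' => simpa using h.add h'
    | smul c w _ h => simpa using h.const_smul c
  rw [Metric.tendsto_nhds]
  intro ε hε
  obtain ⟨w, hw, hvw⟩ := Metric.mem_closure_iff.1 hv (ε / (2 * (|R| + 1))) (by positivity)
  filter_upwards [Metric.tendsto_nhds.1 (hspan w hw) (ε / 2) (by positivity)] with α hα
  rw [dist_zero_right] at hα ⊢
  have h1 : ‖L α (v - w)‖ ≤ ε / 2 := by
    refine ((L α).le_of_opNorm_le (hL α) _).trans ?_
    rw [dist_eq_norm] at hvw
    calc R * ‖v - w‖ ≤ (|R| + 1) * (ε / (2 * (|R| + 1))) := by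
          gcongr
          exact (le_abs_self R).trans (by linarith)
      _ = ε / 2 := by field_simp
  calc ‖L α v‖ = ‖L α (v - w) + L α w‖ := by rw [← map_add, sub_add_cancel]
    _ ≤ ‖L α (v - w)‖ + ‖L α w‖ := norm_add_le _ _
    _ < ε := by linarith

theorem mem_closure_span_delta {Γ : Type*} (f : ell2 Γ) :
    f ∈ closure (Submodule.span ℂ (Set.range (delta (Γ := Γ))) : Set (ell2 Γ)) :=
  mem_closure_of_tendsto (hasSum_delta f) (Eventually.of_forall fun _ =>
    sum_mem fun x _ => Submodule.smul_mem _ _ (Submodule.subset_span ⟨x, rfl⟩))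

/-- For bounded nets of operators, convergence to zero of the matrix entries implies weak
convergence. -/
theorem tendsto_inner_of_entries {Γ ι : Type*} {l : Filter ι} {b : ι → ell2 Γ →L[ℂ] ell2 Γ}
    {R : ℝ} (hb : ∀ α, ‖b α‖ ≤ R)
    (h : ∀ z y, Tendsto (fun α => b α (delta y) z) l (𝓝 0)) (ξ η : ell2 Γ) :
    Tendsto (fun α => ⟪η, b α ξ⟫_ℂ) l (𝓝 0) := by
  have h1 : ∀ z, Tendsto (fun α => ⟪delta z, b α ξ⟫_ℂ) l (𝓝 0) := by
    intro z
    refine tendsto_zero_of_mem_closure_span (L := fun α => (innerSL ℂ (delta z)).comp (b α))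
      (R := R) (fun α => ?_) ?_ (mem_closure_span_delta ξ)
    · refine (ContinuousLinearMap.opNorm_comp_le _ _).trans ?_
      rw [innerSL_apply_norm, norm_delta, one_mul]
      exact hb α
    · rintro _ ⟨y, rfl⟩
      simpa [inner_delta_left] using h z y
  -- The density argument needs linearity in η, so the inner product is conjugated to place η in the
  -- linear slot.
  have h2 : Tendsto (fun α => ⟪b α ξ, η⟫_ℂ) l (𝓝 0) := by
    refine tendsto_zero_of_mem_closure_span (L := fun α => innerSL ℂ (b α ξ))
      (R := R * ‖ξ‖) (fun α => ?_) ?_ (mem_closure_span_delta η)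
    · rw [innerSL_apply_norm]
      exact (b α).le_of_opNorm_le (hb α) ξ
    · rintro _ ⟨z, rfl⟩
      have := (Complex.continuous_conj.tendsto _).comp (h1 z)
      simpa [Function.comp_def] using this
  have := (Complex.continuous_conj.tendsto _).comp h2
  simpa [Function.comp_def] using this

/-- For bounded nets, convergence of the matrix entries implies σ-weak convergence. -/
theorem tendsto_predual_of_entries {Γ ι : Type*} [Group Γ] {l : Filter ι}
    {b : ι → (groupVN Γ).toStarSubalgebra} {R : ℝ} (hb : ∀ α, ‖b α‖ ≤ R)
    (h : ∀ z y, Tendsto (fun α => (b α : ell2 Γ →L[ℂ] ell2 Γ) (delta y) z) l (𝓝 0))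
    {ω : (groupVN Γ).toStarSubalgebra →L[ℂ] ℂ} (hω : ω ∈ predual (groupVN Γ)) :
    Tendsto (fun α => ω (b α)) l (𝓝 0) := by
  obtain ⟨ξ, η, hξ, hη, hω⟩ := hω
  simp only [hω]
  -- Dominating series for the interchange of limit and sum, from ‖ξ‖ ‖η‖ ≤ ‖ξ‖² + ‖η‖².
  have hsum : Summable fun n => R * (‖ξ n‖ ^ 2 + ‖η n‖ ^ 2) := (hξ.add hη).mul_left R
  have := tendsto_tsum_of_dominated_convergence (𝓕 := l)
    (f := fun α n => ⟪η n, (b α : ell2 Γ →L[ℂ] ell2 Γ) (ξ n)⟫_ℂ) (g := fun _ => 0) hsum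
    (fun n => tendsto_inner_of_entries hb h (ξ n) (η n)) (Eventually.of_forall fun α n => by
      have hR : 0 ≤ R := (norm_nonneg _).trans (hb α)
      have h1 : ‖(b α : ell2 Γ →L[ℂ] ell2 Γ) (ξ n)‖ ≤ R * ‖ξ n‖ :=
        ContinuousLinearMap.le_of_opNorm_le _ (hb α) _
      calc _ ≤ ‖η n‖ * ‖(b α : ell2 Γ →L[ℂ] ell2 Γ) (ξ n)‖ := norm_inner_le_norm _ _
        _ ≤ ‖η n‖ * (R * ‖ξ n‖) := by gcongr
        _ = R * (‖η n‖ * ‖ξ n‖) := by ring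
        _ ≤ _ := by
          gcongr
          nlinarith [sq_nonneg (‖η n‖ - ‖ξ n‖), sq_nonneg ‖η n‖, sq_nonneg ‖ξ n‖])
  simpa using this

variable {Γ : Type*} [Group Γ]

/-- λ(Γ) is a submonoid closed under adjoints, so its linear span is already a *-algebra. -/
theorem adjoin_leftReg_le_span : Subalgebra.toSubmodule
    (StarAlgebra.adjoin ℂ (Set.range (leftReg (Γ := Γ)))).toSubalgebra ≤
      Submodule.span ℂ (Set.range (leftReg (Γ := Γ))) := by
  have hstar : star (Set.range (leftReg (Γ := Γ))) ⊆ Set.range (leftReg (Γ := Γ)) := by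
    intro b hb
    obtain ⟨x, hx⟩ := Set.mem_star.1 hb
    exact ⟨x⁻¹, by rw [← star_leftReg, hx, star_star]⟩
  set N : Submonoid (ell2 Γ →L[ℂ] ell2 Γ) :=
    { carrier := Set.range (leftReg (Γ := Γ))
      mul_mem' := by
        rintro _ _ ⟨x, rfl⟩ ⟨y, rfl⟩
        exact ⟨x * y, leftReg_mul x y⟩
      one_mem' := ⟨1, leftReg_one⟩ } with hN
  rw [StarAlgebra.adjoin_toSubalgebra, Set.union_eq_left.2 hstar, Algebra.adjoin_eq_span]
  exact Submodule.span_mono (show Submonoid.closure (Set.range (leftReg (Γ := Γ))) ≤ N from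
    Submonoid.closure_le.2 le_rfl)

theorem mem_closure_span_leftReg (a : reducedCStar Γ) :
    a ∈ closure (Submodule.span ℂ (Set.range fun x : Γ =>
      (⟨leftReg x, leftReg_mem_reducedCStar x⟩ : reducedCStar Γ)) : Set (reducedCStar Γ)) := by
  rw [closure_subtype]
  have h1 : (a : ell2 Γ →L[ℂ] ell2 Γ) ∈
      closure (Submodule.span ℂ (Set.range (leftReg (Γ := Γ))) : Set _) :=
    closure_mono (fun b hb => adjoin_leftReg_le_span hb) a.2
  convert h1 using 2
  have h2 := Submodule.map_span (Subalgebra.toSubmodule (reducedCStar Γ).toSubalgebra).subtype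
    (Set.range fun x : Γ => (⟨leftReg x, leftReg_mem_reducedCStar x⟩ : reducedCStar Γ))
  rw [← Set.range_comp] at h2
  exact congrArg (fun N : Submodule ℂ (ell2 Γ →L[ℂ] ell2 Γ) => (N : Set (ell2 Γ →L[ℂ] ell2 Γ))) h2

end Convergence

/-! ### Approximation by finitely supported functions and the norm of A(Γ). -/

section Approximation

variable {Γ : Type*} [Group Γ]

/-- Sesquilinear telescoping: each error term contains one small vector, so it is small both
uniformly and as a Schur multiplier. -/
theorem coeff_sub_coeff (f g f₀ g₀ : ell2 Γ) :
    coeff f g = coeff f₀ g₀ + (coeff (f - f₀) g + coeff f₀ (g - g₀)) := by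
  ext x
  simp only [Pi.add_apply, coeff_eq_inner, map_sub, inner_sub_left, inner_sub_right]
  ring

theorem coeff_finite_support (F : Finset Γ) (ξ η : Γ → ℂ) :
    ∃ K : Finset Γ, ∀ x ∉ K,
      coeff (∑ y ∈ F, ξ y • delta y) (∑ z ∈ F, η z • delta z) x = 0 := by
  classical
  -- ⟨λ(x)δ_y, δ_z⟩ is nonzero only for x = z y⁻¹, so the support lies in F F⁻¹.
  refine ⟨(F ×ˢ F).image fun p => p.1 * p.2⁻¹, fun x hx => ?_⟩
  rw [coeff_eq_inner, inner_sum_delta]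
  refine Finset.sum_eq_zero fun z hz => Finset.sum_eq_zero fun y hy => ?_
  have : z ≠ x * y := fun h => hx (Finset.mem_image.2
    ⟨(z, y), Finset.mem_product.2 ⟨hz, hy⟩, by simp [h]⟩)
  rw [leftReg_delta, delta_apply, if_neg this, mul_zero]

/-- Every coefficient is approximated by finitely supported ones. -/
theorem exists_coeff_approx (f g : ell2 Γ) {ε : ℝ} (hε : 0 < ε) :
    ∃ f₀ g₀ : ell2 Γ, (∃ K : Finset Γ, ∀ x ∉ K, coeff f₀ g₀ x = 0) ∧
      ‖f - f₀‖ * ‖g‖ + ‖f₀‖ * ‖g - g₀‖ < ε := by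
  have ht : Tendsto (fun F : Finset Γ => ‖f - ∑ x ∈ F, f x • delta x‖ * ‖g‖ +
      ‖∑ x ∈ F, f x • delta x‖ * ‖g - ∑ x ∈ F, g x • delta x‖) atTop
      (𝓝 (‖f - f‖ * ‖g‖ + ‖f‖ * ‖g - g‖)) :=
    ((tendsto_const_nhds.sub (tendsto_sum_smul_delta f)).norm.mul_const _).add
      ((tendsto_sum_smul_delta f).norm.mul
        (tendsto_const_nhds.sub (tendsto_sum_smul_delta g)).norm)
  simp only [sub_self, norm_zero, zero_mul, mul_zero, add_zero] at ht
  obtain ⟨F, hF⟩ := (ht.eventually (gt_mem_nhds hε)).exists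
  exact ⟨_, _, coeff_finite_support F f g, hF⟩

theorem schurBound_one : SchurBound (1 : Γ → ℂ) 1 := by
  intro n a r hr _ ha
  rw [formBound_iff_kernelBound hr] at ha
  simpa using ha

theorem leftReg_sum_delta (c : Γ →₀ ℂ) (z y : Γ) :
    (c.sum fun x w => w • leftReg x) (delta y) z = c (z * y⁻¹) := by
  classical
  rw [← inner_delta_left, Finsupp.sum, sum_apply, inner_sum]
  have : ∀ x ∈ c.support, ⟪delta z, (c x • leftReg x) (delta y)⟫_ℂ =
      if z * y⁻¹ = x then c x else 0 := by
    intro x _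
    rw [smul_apply, leftReg_delta, inner_smul_right, inner_delta_left,
      delta_apply]
    by_cases h : z = x * y
    · simp [h]
    · have h' : z * y⁻¹ ≠ x := fun h' => h (mul_inv_eq_iff_eq_mul.1 h')
      simp [h, h']
  rw [Finset.sum_congr rfl this, Finset.sum_ite_eq]
  simp +contextual

theorem leftReg_sum_mem_groupVN (c : Γ →₀ ℂ) :
    (c.sum fun x w => w • leftReg x) ∈ (groupVN Γ).toStarSubalgebra :=
  sum_mem fun x _ => StarSubalgebra.smul_mem _ (leftReg_mem_groupVN x) _

theorem fourierNorm_le {u : Γ → ℂ} {C : ℝ}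
    (h : ∀ c : Γ →₀ ℂ, ‖c.sum fun x z => z • leftReg x‖ ≤ 1 →
      ‖c.sum fun x z => z * u x‖ ≤ C) : fourierNorm u ≤ ENNReal.ofReal C := by
  refine iSup₂_le fun c hc => ?_
  rw [← ofReal_norm]
  exact ENNReal.ofReal_le_ofReal (h c hc)

theorem fourierNorm_add_le (u v : Γ → ℂ) :
    fourierNorm (u + v) ≤ fourierNorm u + fourierNorm v := by
  refine iSup₂_le fun c hc => ?_
  have : (c.sum fun x z => z * (u + v) x) =
      (c.sum fun x z => z * u x) + c.sum fun x z => z * v x := by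
    simp [Finsupp.sum, mul_add, Finset.sum_add_distrib]
  rw [this]
  exact (enorm_add_le _ _).trans (add_le_add
    (le_iSup₂_of_le (f := fun (c : Γ →₀ ℂ) (_ : ‖c.sum fun x z => z • leftReg x‖ ≤ 1) =>
      ‖c.sum fun x z => z * u x‖ₑ) c hc le_rfl)
    (le_iSup₂_of_le (f := fun (c : Γ →₀ ℂ) (_ : ‖c.sum fun x z => z • leftReg x‖ ≤ 1) =>
      ‖c.sum fun x z => z * v x‖ₑ) c hc le_rfl))

theorem enorm_apply_le_fourierNorm (u : Γ → ℂ) (x : Γ) : ‖u x‖ₑ ≤ fourierNorm u := by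
  refine le_iSup₂_of_le (Finsupp.single x 1) ?_ (le_of_eq ?_)
  · simpa using norm_leftReg_le x
  · simp

/-- The number c(x) is a coordinate of (∑ c λ) δ₁, so it has modulus at most 1 when the operator is
a contraction. -/
theorem fourierNorm_le_sum {u : Γ → ℂ} {K : Finset Γ} (hK : ∀ x ∉ K, u x = 0) :
    fourierNorm u ≤ ENNReal.ofReal (∑ x ∈ K, ‖u x‖) := by
  classical
  refine fourierNorm_le fun c hc => ?_
  have h1 : (c.sum fun x z => z * u x) = ∑ x ∈ K, c x * u x := by
    rw [Finsupp.sum_of_support_subset (s := c.support ∪ K) c Finset.subset_union_left _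
      (by simp)]
    refine (Finset.sum_subset Finset.subset_union_right fun x _ hx => ?_).symm
    rw [hK x hx, mul_zero]
  rw [h1]
  refine (norm_sum_le _ _).trans (Finset.sum_le_sum fun x _ => ?_)
  rw [norm_mul]
  refine mul_le_of_le_one_left (norm_nonneg _) ?_
  have h2 := leftReg_sum_delta c x 1
  rw [inv_one, mul_one] at h2
  rw [← h2]
  refine (norm_apply_le _ _).trans ((ContinuousLinearMap.le_of_opNorm_le _ hc _).trans ?_)
  rw [norm_delta, mul_one]

/-- A completely bounded Schur multiplier is bounded for the norm of the Fourier algebra. -/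
theorem fourierNorm_mul_coeff_le {θ : Γ → ℂ} {C : ℝ} (hC : 0 ≤ C) (hθ : SchurBound θ C)
    (f g : ell2 Γ) : fourierNorm (θ * coeff f g) ≤ ENNReal.ofReal (C * (‖f‖ * ‖g‖)) := by
  refine fourierNorm_le fun c hc => ?_
  have ha : FormBound (fun _ _ : Fin 1 => c.sum fun x w => w • leftReg x) 1 := by
    intro v w
    simp only [Fin.sum_univ_one, Real.sqrt_sq (norm_nonneg _), one_mul]
    refine (norm_inner_le_norm _ _).trans ?_
    rw [mul_comm]
    gcongr
    simpa using ContinuousLinearMap.le_of_opNorm_le _ hc (v 0)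
  have hk := hθ 1 _ 1 zero_le_one (fun _ _ => leftReg_sum_mem_groupVN c) ha
  -- Pairing c with θψ, for ψ the coefficient of f and g, gives ⟨b f, g⟩; the Schur bound for 1 × 1
  -- matrices controls b by C.
  set b : ell2 Γ →L[ℂ] ell2 Γ := ∑ x ∈ c.support, (c x * θ x) • leftReg x with hb
  set e : Γ →₀ ℂ := Finsupp.onFinset c.support (fun x => c x * θ x) (fun x hx => by
    rw [Finsupp.mem_support_iff]
    exact left_ne_zero_of_mul hx) with he
  have hbe : b = e.sum fun x w => w • leftReg x := by
    rw [Finsupp.sum_of_support_subset e Finsupp.support_onFinset_subset _ (by simp)]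
    rfl
  have hbound : FormBound (fun _ _ : Fin 1 => b) (C * 1) := by
    rw [formBound_iff_kernelBound (by linarith)]
    simp only [leftReg_sum_delta] at hk
    simp only [hbe, leftReg_sum_delta]
    convert hk using 5
    exact mul_comm _ _
  have h1 := hbound (fun _ => f) (fun _ => g)
  simp only [Fin.sum_univ_one, Real.sqrt_sq (norm_nonneg _), mul_one] at h1
  have h2 : (c.sum fun x z => z * (θ * coeff f g) x) = ⟪g, b f⟫_ℂ := by
    rw [hb, sum_apply, inner_sum, Finsupp.sum]
    refine Finset.sum_congr rfl fun x _ => ?_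
    rw [smul_apply, inner_smul_right, ← coeff_eq_inner, Pi.mul_apply,
      mul_assoc]
  rw [h2, ← mul_assoc]
  exact h1

theorem schurBound_coeff_sub {f g f₀ g₀ : ell2 Γ} {ε : ℝ}
    (h : ‖f - f₀‖ * ‖g‖ + ‖f₀‖ * ‖g - g₀‖ ≤ ε) :
    SchurBound (coeff (f - f₀) g + coeff f₀ (g - g₀)) ε :=
  ((schurBound_coeff _ _).add (schurBound_coeff _ _)).mono h

/-- A function in `A(Γ)` with `M₀A`-norm at most `k` is approximated uniformly by finitely
supported Schur multipliers with the same bound. -/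
theorem exists_finite_support_approx {φ : Γ → ℂ} {k : ℝ} (hk : 1 ≤ k)
    (hφ : φ ∈ fourierAlgebra Γ) (hcb : multiplierCBNorm φ ≤ ENNReal.ofReal k) {ε : ℝ}
    (hε : 0 < ε) :
    ∃ u : Γ → ℂ, (∃ K : Finset Γ, ∀ x ∉ K, u x = 0) ∧ SchurBound u k ∧
      ∀ x, ‖u x - φ x‖ ≤ ε := by
  obtain ⟨f, g, rfl⟩ := hφ
  set M := ‖f‖ * ‖g‖ with hM
  have hM0 : 0 ≤ M := by positivity
  -- The final error is 2δM from the rescaling plus δ from the truncation.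
  obtain ⟨δ, hδ0, hδ⟩ : ∃ δ : ℝ, 0 < δ ∧ δ * (2 * M + 1) = ε :=
    ⟨ε / (2 * M + 1), by positivity, by field_simp⟩
  have hlt : multiplierCBNorm (coeff f g) < ENNReal.ofReal (k + δ) :=
    hcb.trans_lt ((ENNReal.ofReal_lt_ofReal_iff (by linarith)).2 (by linarith))
  obtain ⟨S, hS⟩ := iInf_lt_iff.1 hlt
  obtain ⟨⟨_, hS⟩, hScb⟩ := iInf_lt_iff.1 hS
  have hschur := schurBound_of_isTransposedMultiplication (by linarith) hS hScb.le
  obtain ⟨f₀, g₀, ⟨K, hK⟩, happrox⟩ := exists_coeff_approx f g hδ0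
  set w := coeff (f - f₀) g + coeff f₀ (g - g₀) with hw
  have hdec : coeff f₀ g₀ = coeff f g + -w := by
    rw [coeff_sub_coeff f g f₀ g₀, ← hw, add_neg_cancel_right]
  have hw' : ∀ x, ‖w x‖ ≤ δ := fun x =>
    ((norm_add_le _ _).trans (add_le_add (norm_coeff_le _ _ x) (norm_coeff_le _ _ x))).trans
      happrox.le
  -- The truncated function has Schur bound k + 2δ, one δ from the infimum defining the multiplier
  -- norm and one from truncation; c scales this back to k.
  set c : ℝ := k / (k + 2 * δ) with hc
  have hc0 : 0 ≤ c := by positivity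
  -- The denominator k + 2δ is at least 1 because k ≥ 1.
  have hc1 : 1 - c ≤ 2 * δ := by
    have : 1 - c = 2 * δ / (k + 2 * δ) := by rw [hc]; field_simp; ring
    rw [this]
    exact div_le_self (by positivity) (by linarith)
  have hc2 : 0 ≤ 1 - c := by
    rw [hc, sub_nonneg]
    exact div_le_one_of_le₀ (by linarith) (by linarith)
  refine ⟨(c : ℂ) • coeff f₀ g₀, ⟨K, fun x hx => by simp [hK x hx]⟩, ?_, fun x => ?_⟩
  · have h1 : SchurBound (coeff f₀ g₀) (k + δ + δ) := by
      rw [hdec]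
      exact hschur.add (schurBound_coeff_sub happrox.le).neg
    refine (h1.smul c).mono (le_of_eq ?_)
    rw [Complex.norm_real, Real.norm_of_nonneg hc0, hc]
    field_simp
    ring
  · have h1 : ((c : ℂ) • coeff f₀ g₀) x - coeff f g x =
        -((1 - c : ℝ) : ℂ) * coeff f g x - c * w x := by
      rw [hdec]
      simp only [Pi.smul_apply, Pi.add_apply, Pi.neg_apply, smul_eq_mul]
      push_cast
      ring
    rw [h1]
    refine (norm_sub_le _ _).trans ?_
    rw [norm_mul, norm_mul, norm_neg, Complex.norm_real, Complex.norm_real,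
      Real.norm_of_nonneg hc0, Real.norm_of_nonneg hc2]
    calc (1 - c) * ‖coeff f g x‖ + c * ‖w x‖ ≤ 2 * δ * M + 1 * δ := by
          gcongr
          · exact norm_coeff_le f g x
          · linarith
          · exact hw' x
      _ = δ * (2 * M + 1) := by ring
      _ ≤ ε := hδ.le

/-- For finitely supported ψ pointwise convergence suffices. The general case follows by density,
since φ - 1 acts on A(Γ) with bound k + 1, whence the tolerance δ / (k + 1). -/
theorem tendsto_fourierNorm {ι : Type*} {l : Filter ι} {φ : ι → Γ → ℂ} {k : ℝ} (hk : 0 ≤ k)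
    (hφ : ∀ α, SchurBound (φ α) k) (h1 : ∀ x, Tendsto (fun α => φ α x) l (𝓝 1)) {ψ : Γ → ℂ}
    (hψ : ψ ∈ fourierAlgebra Γ) :
    Tendsto (fun α => fourierNorm (φ α * ψ - ψ)) l (𝓝 0) := by
  obtain ⟨f, g, rfl⟩ := hψ
  rw [ENNReal.tendsto_nhds_zero]
  intro ε hε
  rcases eq_or_ne ε ⊤ with rfl | hεt
  · simp
  have hε' : 0 < ε.toReal := ENNReal.toReal_pos hε.ne' hεt
  set δ := ε.toReal / 2 with hδ
  obtain ⟨f₀, g₀, ⟨K, hK⟩, happrox⟩ := exists_coeff_approx f g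
    (ε := δ / (k + 1)) (by positivity)
  have hlim : Tendsto (fun α => ∑ x ∈ K, ‖((φ α - 1) * coeff f₀ g₀) x‖) l (𝓝 0) := by
    rw [← Finset.sum_const_zero (s := K)]
    refine tendsto_finsetSum _ fun x _ => ?_
    have := (((h1 x).sub_const 1).mul_const (coeff f₀ g₀ x)).norm
    simpa using this
  filter_upwards [hlim.eventually (gt_mem_nhds (show 0 < δ by positivity))] with α hα
  have hθ : SchurBound (φ α - 1) (k + 1) := by
    rw [sub_eq_add_neg]
    exact (hφ α).add schurBound_one.neg
  have hsplit : φ α * coeff f g - coeff f g = (φ α - 1) * coeff f₀ g₀ +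
      ((φ α - 1) * coeff (f - f₀) g + (φ α - 1) * coeff f₀ (g - g₀)) := by
    rw [coeff_sub_coeff f g f₀ g₀]
    ring
  rw [hsplit]
  have hk1 : 0 ≤ k + 1 := by linarith
  calc _ ≤ _ := fourierNorm_add_le _ _
    _ ≤ ENNReal.ofReal δ + (ENNReal.ofReal ((k + 1) * (‖f - f₀‖ * ‖g‖)) +
        ENNReal.ofReal ((k + 1) * (‖f₀‖ * ‖g - g₀‖))) := by
      refine add_le_add ?_ ((fourierNorm_add_le _ _).trans (add_le_add
        (fourierNorm_mul_coeff_le hk1 hθ _ _) (fourierNorm_mul_coeff_le hk1 hθ _ _)))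
      refine (fourierNorm_le_sum fun x hx => ?_).trans (ENNReal.ofReal_le_ofReal hα.le)
      rw [Pi.mul_apply, hK x hx, mul_zero]
    _ = ENNReal.ofReal (δ + ((k + 1) * (‖f - f₀‖ * ‖g‖ + ‖f₀‖ * ‖g - g₀‖))) := by
      rw [← ENNReal.ofReal_add (by positivity) (by positivity),
        ← ENNReal.ofReal_add (by positivity) (by positivity)]
      congr 1
      ring
    _ ≤ ENNReal.ofReal ε.toReal := by
      refine ENNReal.ofReal_le_ofReal ?_
      have : (k + 1) * (‖f - f₀‖ * ‖g‖ + ‖f₀‖ * ‖g - g₀‖) ≤ (k + 1) * (δ / (k + 1)) := by gcongr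
      rw [mul_div_cancel₀ _ (by positivity)] at this
      linarith
    _ = ε := ENNReal.ofReal_toReal hεt

theorem exists_eq_sum_of_finiteDimensional_range {E G : Type*} [NormedAddCommGroup E]
    [NormedSpace ℂ E] [NormedAddCommGroup G] [NormedSpace ℂ G] (T : E →L[ℂ] G)
    (hT : FiniteDimensional ℂ (LinearMap.range (T : E →ₗ[ℂ] G))) :
    ∃ (n : ℕ) (ω : Fin n → E →L[ℂ] ℂ) (b : Fin n → G), ∀ v, T v = ∑ i, ω i v • b i := by
  set B := Module.finBasis ℂ (LinearMap.range (T : E →ₗ[ℂ] G)) with hB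
  set t : E →L[ℂ] LinearMap.range (T : E →ₗ[ℂ] G) :=
    T.codRestrict _ fun v => ⟨v, rfl⟩ with ht
  refine ⟨_, fun i => (LinearMap.toContinuousLinearMap (B.coord i)).comp t, fun i => B i,
    fun v => ?_⟩
  have h : T v = ((∑ i, B.repr (t v) i • B i : LinearMap.range (T : E →ₗ[ℂ] G)) : G) := by
    rw [B.sum_repr]
    rfl
  rw [Submodule.coe_sum] at h
  exact h

/-- The symbol of a finite rank map is square summable. -/
theorem memℓp_symbol {A : StarSubalgebra ℂ (ell2 Γ →L[ℂ] ell2 Γ)} (hA : ∀ x, leftReg x ∈ A)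
    {T : A →L[ℂ] A} (hT : IsFiniteRank T) : Memℓp (symbol hA T) 2 := by
  obtain ⟨n, ω, b, h⟩ := exists_eq_sum_of_finiteDimensional_range T hT
  -- Each term is a product of the bounded function ω_i(λ(x)) and the ℓ² function b_i δ₁.
  have hsum : symbol hA T = fun x => ∑ i, ω i ⟨leftReg x, hA x⟩ *
      (b i : ell2 Γ →L[ℂ] ell2 Γ) (delta 1) x := by
    ext x
    rw [symbol, h, ← inner_delta_left, AddSubmonoidClass.coe_finsetSum, sum_apply, inner_sum]
    refine Finset.sum_congr rfl fun i _ => ?_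
    rw [← inner_delta_left, ← inner_smul_right]
    rfl
  rw [hsum]
  refine Memℓp.finsetSum _ fun i _ => ?_
  refine memℓp_bounded_mul (M := ‖ω i‖ * 1) (fun x => ?_) (lp.memℓp _)
  refine ((ω i).le_opNorm _).trans ?_
  gcongr
  exact norm_leftReg_le x

end Approximation

/-! ### Passage between approximate units and finite rank nets. -/

section Main

theorem norm_sub_id_le_of_cbNorm_le {H : Type*} [NormedAddCommGroup H] [InnerProductSpace ℂ H]
    [CompleteSpace H] {A : StarSubalgebra ℂ (H →L[ℂ] H)} {T : A →L[ℂ] A} {k : ℝ}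
    (hk : 0 ≤ k) (hT : cbNorm T ≤ ENNReal.ofReal k) :
    ‖T - ContinuousLinearMap.id ℂ A‖ ≤ k + 1 :=
  (norm_sub_le _ _).trans
    (add_le_add (norm_le_of_cbNorm_le hk hT) ContinuousLinearMap.norm_id_le)

theorem isDirectedOrder_prod_nat (ι : Type*) [Preorder ι] [IsDirectedOrder ι] :
    IsDirectedOrder (ι × ℕ) :=
  ⟨fun p q => by
    obtain ⟨r, hp, hq⟩ := exists_ge_ge p.1 q.1
    exact ⟨(r, max p.2 q.2), ⟨hp, le_max_left _ _⟩, ⟨hq, le_max_right _ _⟩⟩⟩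

variable {Γ : Type u} [Group Γ]

/-- An approximate unit of `A(Γ)` bounded in `M₀A(Γ)` yields a net of finitely supported Schur
multipliers with the same bound that converges pointwise to `1`. -/
theorem exists_finite_support_net {k : ℝ} (hk : 1 ≤ k) {ι : Type u} [Preorder ι]
    {φ : ι → Γ → ℂ} (hφ : ∀ α, φ α ∈ fourierAlgebra Γ)
    (hunit : ∀ ψ ∈ fourierAlgebra Γ,
      Tendsto (fun α => fourierNorm (φ α * ψ - ψ)) atTop (𝓝 0))
    (hcb : ∀ α, multiplierCBNorm (φ α) ≤ ENNReal.ofReal k) :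
    ∃ u : ι × ℕ → ell2 Γ, (∀ p, ∃ K : Finset Γ, ∀ x ∉ K, u p x = 0) ∧
      (∀ p, SchurBound (u p : Γ → ℂ) k) ∧ ∀ x, Tendsto (fun p => u p x) atTop (𝓝 1) := by
  -- The second index makes the truncation error 1/(n + 1) vanish along the product net.
  have hex := fun p : ι × ℕ => exists_finite_support_approx hk (hφ p.1) (hcb p.1)
    (ε := 1 / ((p.2 : ℝ) + 1)) (by positivity)
  choose u hfin hschur happrox using hex
  choose K hK using hfin
  have hmem : ∀ p, Memℓp (u p) 2 := fun p => memℓp_two_iff.2 <|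
    summable_of_ne_finset_zero (s := K p) fun x hx => by simp [hK p x hx]
  refine ⟨fun p => ⟨u p, hmem p⟩, fun p => ⟨K p, hK p⟩, hschur, fun x => ?_⟩
  have h1 : Tendsto (fun α => φ α x) atTop (𝓝 1) := by
    -- This coefficient takes the value 1 at x, and evaluation at x is bounded by the norm of A(Γ).
    have h := hunit (coeff (delta 1) (delta x)) ⟨_, _, rfl⟩
    have hx : coeff (delta 1) (delta x) x = 1 := by
      rw [coeff_eq_inner, leftReg_delta, inner_delta_left, delta_apply, mul_one, if_pos rfl]
    rw [tendsto_iff_edist_tendsto_0]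
    refine tendsto_of_tendsto_of_tendsto_of_le_of_le tendsto_const_nhds h
      (fun _ => zero_le) fun α => ?_
    have := enorm_apply_le_fourierNorm (φ α * coeff (delta 1) (delta x) -
      coeff (delta 1) (delta x)) x
    rwa [Pi.sub_apply, Pi.mul_apply, hx, mul_one, ← edist_eq_enorm_sub] at this
  have h2 : Tendsto (fun p : ι × ℕ => u p x - φ p.1 x) atTop (𝓝 0) := by
    rw [← prod_atTop_atTop_eq]
    exact squeeze_zero_norm (fun p => happrox p x)
      ((tendsto_one_div_add_atTop_nhds_zero_nat (𝕜 := ℝ)).comp tendsto_snd)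
  have h3 : Tendsto (fun p : ι × ℕ => φ p.1 x) atTop (𝓝 1) := by
    rw [← prod_atTop_atTop_eq]
    exact h1.comp tendsto_fst
  simpa using h2.add h3

/-- Finite rank maps whose symbols converge to `1` yield an approximate unit of `A(Γ)`. -/
theorem approximateUnit_of_finiteRank {A : StarSubalgebra ℂ (ell2 Γ →L[ℂ] ell2 Γ)}
    (hA : ∀ x, leftReg x ∈ A) (hA' : A ≤ (groupVN Γ).toStarSubalgebra) {k : ℝ} (hk : 0 ≤ k)
    {ι : Type u} {l : Filter ι} {T : ι → A →L[ℂ] A} (hfin : ∀ α, IsFiniteRank (T α))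
    (hcb : ∀ α, cbNorm (T α) ≤ ENNReal.ofReal k)
    (hlim : ∀ x, Tendsto (fun α => symbol hA (T α) x) l (𝓝 1)) :
    (∀ α, symbol hA (T α) ∈ fourierAlgebra Γ) ∧
      (∀ ψ ∈ fourierAlgebra Γ,
        Tendsto (fun α => fourierNorm (symbol hA (T α) * ψ - ψ)) l (𝓝 0)) ∧
      ∀ α, multiplierCBNorm (symbol hA (T α)) ≤ ENNReal.ofReal k :=
  ⟨fun α => mem_fourierAlgebra_of_memℓp (memℓp_symbol hA (hfin α)),
    fun _ hψ => tendsto_fourierNorm hk (fun α => schurBound_symbol hA hA' hk (hcb α)) hlim hψ,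
    fun α => multiplierCBNorm_le (φ := ⟨_, memℓp_symbol hA (hfin α)⟩) hk
      (schurBound_symbol hA hA' hk (hcb α))⟩

theorem tendsto_multOp_reducedCStar {k : ℝ} (hk : 0 ≤ k) {ι : Type*} {l : Filter ι}
    {u : ι → ell2 Γ} (hu : ∀ p, SchurBound (u p : Γ → ℂ) k)
    (hlim : ∀ x, Tendsto (fun p => u p x) l (𝓝 1)) (a : reducedCStar Γ) :
    Tendsto (fun p => ‖multOp leftReg_mem_reducedCStar isClosed_reducedCStar (u p) a - a‖) l
      (𝓝 0) := by
  refine tendsto_zero_iff_norm_tendsto_zero.1 ?_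
  refine tendsto_zero_of_mem_closure_span (L := fun p =>
    multOp leftReg_mem_reducedCStar isClosed_reducedCStar (u p) -
      ContinuousLinearMap.id ℂ (reducedCStar Γ)) (R := k + 1)
    (fun p => norm_sub_id_le_of_cbNorm_le hk (cbNorm_le_of_schurBound reducedCStar_le_groupVN
      (hasSchurEntries_multOp _ _ reducedCStar_le_groupVN _) hk (hu p))) ?_
    (mem_closure_span_leftReg a)
  rintro _ ⟨x, rfl⟩
  have h := ((hlim x).sub_const 1).smul_const
    (⟨leftReg x, leftReg_mem_reducedCStar x⟩ : reducedCStar Γ)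
  rw [sub_self, zero_smul] at h
  refine h.congr fun p => ?_
  rw [sub_apply, multOp_leftReg, ContinuousLinearMap.id_apply, sub_smul,
    one_smul]

/-- The span of λ(Γ) need not be norm dense here, so entries are used instead: those of T a - a are
(φ(z y⁻¹) - 1) times those of `a`. -/
theorem tendsto_multOp_groupVN {k : ℝ} (hk : 0 ≤ k) {ι : Type*} {l : Filter ι}
    {u : ι → ell2 Γ} (hu : ∀ p, SchurBound (u p : Γ → ℂ) k)
    (hlim : ∀ x, Tendsto (fun p => u p x) l (𝓝 1)) (a : (groupVN Γ).toStarSubalgebra)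
    {ω : (groupVN Γ).toStarSubalgebra →L[ℂ] ℂ} (hω : ω ∈ predual (groupVN Γ)) :
    Tendsto (fun p => ω (multOp leftReg_mem_groupVN isClosed_groupVN (u p) a - a)) l (𝓝 0) := by
  refine tendsto_predual_of_entries (R := (k + 1) * ‖a‖) (fun p => ?_) (fun z y => ?_) hω
  · exact ContinuousLinearMap.le_of_opNorm_le _ (norm_sub_id_le_of_cbNorm_le hk
      (cbNorm_le_of_schurBound le_rfl (hasSchurEntries_multOp _ _ le_rfl _) hk (hu p))) a
  · have h := ((hlim (z * y⁻¹)).sub_const 1).mul_const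
      ((a : ell2 Γ →L[ℂ] ell2 Γ) (delta y) z)
    rw [sub_self, zero_mul] at h
    refine h.congr fun p => ?_
    have h1 := hasSchurEntries_multOp leftReg_mem_groupVN isClosed_groupVN le_rfl (u p) a z y
    rw [sub_mul, one_mul, ← h1]
    rfl

theorem symbol_sub_one_eq_inner {A : StarSubalgebra ℂ (ell2 Γ →L[ℂ] ell2 Γ)}
    (hA : ∀ x, leftReg x ∈ A)
    (T : A →L[ℂ] A) (x : Γ) : symbol hA T x - 1 =
      ⟪delta x, ((T ⟨leftReg x, hA x⟩ - ⟨leftReg x, hA x⟩ : A) : ell2 Γ →L[ℂ] ell2 Γ)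
        (delta 1)⟫_ℂ := by
  change _ = ⟪delta x, (T ⟨leftReg x, hA x⟩ : ell2 Γ →L[ℂ] ell2 Γ) (delta 1) -
    leftReg x (delta 1)⟫_ℂ
  rw [inner_sub_right, inner_delta_left, inner_delta_left, leftReg_delta, delta_apply, mul_one,
    if_pos rfl]
  rfl

end Main

end GroupCBAP

end

/-! ### The equivalence. -/

open GroupCBAP Filter Topology in
theorem theorem2p6 {Γ : Type u} [Group Γ] (k : ℝ) (hk : 1 ≤ k) :
    List.TFAE [
      -- `A(Γ)` has an approximate unit with `M₀A`-norms at most `k`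
      ∃ (ι : Type u) (_ : Preorder ι) (_ : IsDirectedOrder ι) (_ : Nonempty ι) (φ : ι → Γ → ℂ),
        (∀ α, φ α ∈ fourierAlgebra Γ) ∧
        (∀ ψ ∈ fourierAlgebra Γ, Tendsto (fun α => fourierNorm (φ α * ψ - ψ)) atTop (𝓝 0)) ∧
        ∀ α, multiplierCBNorm (φ α) ≤ ENNReal.ofReal k,
      -- the reduced group C*-algebra
      ∃ (ι : Type u) (_ : Preorder ι) (_ : IsDirectedOrder ι) (_ : Nonempty ι)
        (T : ι → (reducedCStar Γ →L[ℂ] reducedCStar Γ)),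
        (∀ α, IsFiniteRank (T α)) ∧
        (∀ α, cbNorm (T α) ≤ ENNReal.ofReal k) ∧
        ∀ x, Tendsto (fun α => ‖T α x - x‖) atTop (𝓝 0),
      -- the group von Neumann algebra
      ∃ (ι : Type u) (_ : Preorder ι) (_ : IsDirectedOrder ι) (_ : Nonempty ι)
        (T : ι → ((groupVN Γ).toStarSubalgebra →L[ℂ] (groupVN Γ).toStarSubalgebra)),
        (∀ α, IsSigmaWeaklyContinuous (T α)) ∧
        (∀ α, IsFiniteRank (T α)) ∧
        (∀ α, cbNorm (T α) ≤ ENNReal.ofReal k) ∧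
        ∀ x, ∀ ω ∈ predual (groupVN Γ), Tendsto (fun α => ω (T α x - x)) atTop (𝓝 0)] := by
  have hk0 : 0 ≤ k := zero_le_one.trans hk
  tfae_have 1 → 2 := by
    rintro ⟨ι, _, _, _, φ, hφ, hunit, hcb⟩
    obtain ⟨u, hfin, hu, hlim⟩ := exists_finite_support_net hk hφ hunit hcb
    refine ⟨ι × ℕ, inferInstance, isDirectedOrder_prod_nat ι, inferInstance, fun p =>
      multOp leftReg_mem_reducedCStar isClosed_reducedCStar (u p), fun p => ?_, fun p => ?_,
      tendsto_multOp_reducedCStar hk0 hu hlim⟩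
    · obtain ⟨K, hK⟩ := hfin p
      exact isFiniteRank_multOp _ _ hK
    · exact cbNorm_le_of_schurBound reducedCStar_le_groupVN
        (hasSchurEntries_multOp _ _ reducedCStar_le_groupVN _) hk0 (hu p)
  tfae_have 1 → 3 := by
    rintro ⟨ι, _, _, _, φ, hφ, hunit, hcb⟩
    obtain ⟨u, hfin, hu, hlim⟩ := exists_finite_support_net hk hφ hunit hcb
    refine ⟨ι × ℕ, inferInstance, isDirectedOrder_prod_nat ι, inferInstance, fun p =>
      multOp leftReg_mem_groupVN isClosed_groupVN (u p), fun p => ?_, fun p => ?_, fun p => ?_,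
      fun a ω hω => tendsto_multOp_groupVN hk0 hu hlim a hω⟩
    · obtain ⟨K, hK⟩ := hfin p
      exact isSigmaWeaklyContinuous_multOp hK
    · obtain ⟨K, hK⟩ := hfin p
      exact isFiniteRank_multOp _ _ hK
    · exact cbNorm_le_of_schurBound le_rfl (hasSchurEntries_multOp _ _ le_rfl _) hk0 (hu p)
  tfae_have 2 → 1 := by
    rintro ⟨ι, _, _, _, T, hfin, hcb, hlim⟩
    refine ⟨ι, inferInstance, inferInstance, inferInstance,
      fun α => symbol leftReg_mem_reducedCStar (T α),
      approximateUnit_of_finiteRank leftReg_mem_reducedCStar reducedCStar_le_groupVN hk0 hfin hcb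
        fun x => ?_⟩
    rw [← tendsto_sub_nhds_zero_iff]
    refine squeeze_zero_norm (fun α => ?_) (hlim ⟨leftReg x, leftReg_mem_reducedCStar x⟩)
    rw [symbol_sub_one_eq_inner]
    refine (norm_inner_le_norm _ _).trans ?_
    rw [norm_delta, one_mul]
    refine (ContinuousLinearMap.le_opNorm _ _).trans ?_
    rw [norm_delta, mul_one]
    rfl
  tfae_have 3 → 1 := by
    rintro ⟨ι, _, _, _, T, _, hfin, hcb, hlim⟩
    refine ⟨ι, inferInstance, inferInstance, inferInstance,
      fun α => symbol leftReg_mem_groupVN (T α),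
      approximateUnit_of_finiteRank leftReg_mem_groupVN le_rfl hk0 hfin hcb fun x => ?_⟩
    rw [← tendsto_sub_nhds_zero_iff]
    -- The normal functional a ↦ ⟨a δ₁, δₓ⟩ reads off the symbol at x, so σ-weak convergence gives
    -- pointwise convergence to 1.
    set ω : (groupVN Γ).toStarSubalgebra →L[ℂ] ℂ := (innerSL ℂ (delta x)).comp
      ((ContinuousLinearMap.apply ℂ (ell2 Γ) (delta (1 : Γ))).comp
        (Subalgebra.toSubmodule (groupVN Γ).toStarSubalgebra.toSubalgebra).subtypeL) with hω
    have h := hlim ⟨leftReg x, leftReg_mem_groupVN x⟩ ω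
      (mem_predual_of_inner (delta 1) (delta x) fun _ => rfl)
    exact h.congr fun α => (symbol_sub_one_eq_inner leftReg_mem_groupVN (T α) x).symm
  tfae_finish
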